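/- **Setting.** Let $G$ be a closed subgroup of some $\mathbb R^n$ (with the induced metric) or $\mathbb R^n$ itself, let $\widehat G$ be its dual group with a Haar measure, and let $A(G)=\{\check F : F\in L^1(\widehat G)\}$, $\check F(x)=\int_{\widehat G}F(\chi)\chi(x)\,d\chi$, $\|\check F\|_A=\|F\|_{L^1}$, be its Fourier algebra. The Segal algebra $S_0(G)$ (Feichtinger's algebra) is the space of all $f=\sum_{n}T_{x_n}f_n$ with $x_n\in G$, $f_n\in A(G)$ supported in the closed unit ball of $G$ and $\sum_n\|f_n\|_A<\infty$, where $T_xf=f(\cdot-x)$; the norm $\|f\|_{S_0}$ is the infimum of $\sum_n\|f_n\|_A$ over all such representations. $S_0'(G)$ is its dual space, $\delta_x\in S_0'(G)$ is the functional $f\mapsto f(x)$, and for $\sigma\in S_0'(G)$, $\varphi\in S_0(G)$ the convolution is $(\sigma*\varphi)(x)=\sigma(\varphi(x-\cdot))$. A lattice $\Lambda\subset\mathbb R^d$ is a discrete subgroup that spans $\mathbb R^d$. **Theorem 5.1.** Let $d\ge 0$. 1. For every closed subgroup $H$ of $\mathbb R^d$ the restriction $R_Hf=f|_H$ is a bounded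 linear map from $S_0(\mathbb R^d)$ onto $S_0(H)$. 2. Let $0\le k<d$ and $g\in S_0(\mathbb R^{d-k})$ with $g(0)=1$. Then $E(f)=f\otimes g$, $(f\otimes g)(x,y)=f(x)g(y)$, defines a bounded linear operator $E:S_0(\mathbb R^k)\to S_0(\mathbb R^d)$, and it is an extension operator for $H=\mathbb R^k\times\{0\}$: $E(f)(x,0)=f(x)$ for all $x\in\mathbb R^k$. 3. Let $0\le k<d$. Then $S_0(\mathbb R^d)=S_0(\mathbb R^k)\,\widehat\otimes\,S_0(\mathbb R^{d-k})$ with the projective tensor norm, up to equivalence of norms: there is an isomorphism of Banach spaces (linear, bijective, continuous in both directions) from the completion of the algebraic tensor product in the projective tensor norm onto $S_0(\mathbb R^d)$ that sends each elementary tensor $f\otimes g$ to the function $(x,y)\mapsto f(x)g(y)$. 4. There is $C>0$ such that $\sum_{k\in\mathbb Z^d}|f(k)|\le C\|f\|_{S_0}$ for all $f\in S_0(\mathbb R^d)$. Likewise, for every lattice $\Lambda\subset\mathbb R^d$ there is $C>0$ such that $\sum_{\lambda\in\Lambda}|f(\lambda)|\le C\|f\|_{S_0}$ for all $f\in S_0(\mathbb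 R^d)$. 5. For every $\varepsilon>0$ there is $\varphi\in S_0(\mathbb R^d)$ with $\varphi(0)=1$ and support in the open ball of radius $\varepsilon$ about $0$. Let $\Lambda\subset\mathbb R^d$ be a lattice and let $\varphi\in S_0(\mathbb R^d)$ satisfy $\varphi(0)=1$ and $\operatorname{supp}\varphi\cap\Lambda\subseteq\{0\}$. Then $$E(\mathbf c)=\sum_{\lambda\in\Lambda}c_\lambda T_\lambda\varphi=\Big(\sum_{\lambda\in\Lambda}c_\lambda\delta_\lambda\Big)*\varphi,\qquad \mathbf c=(c_\lambda)_{\lambda\in\Lambda}\in\ell^1(\Lambda),$$ defines a bounded linear operator $E:\ell^1(\Lambda)\to S_0(\mathbb R^d)$ (the first sum converges unconditionally in $S_0(\mathbb R^d)$, the second in the norm of $S_0'(\mathbb R^d)$), and it is an extension operator: $E(\mathbf c)(\lambda)=c_\lambda$ for all $\lambda\in\Lambda$. -/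

import Mathlib

open MeasureTheory Metric
open scoped TensorProduct

noncomputable section

/-! ### The dual group and the Fourier algebra -/

/-- The dual group `Ĝ` of an additive group `G`: all continuous characters `G → 𝕋`. -/
abbrev CharGroup (G : Type) [AddCommGroup G] [TopologicalSpace G] : Type :=
  PontryaginDual (Multiplicative G)

instance instMeasurableSpaceCharGroup (G : Type) [AddCommGroup G] [TopologicalSpace G] :
    MeasurableSpace (CharGroup G) := borel _

instance instBorelSpaceCharGroup (G : Type) [AddCommGroup G] [TopologicalSpace G] :
    BorelSpace (CharGroup G) := ⟨rfl⟩

section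
variable {G : Type} [NormedAddCommGroup G]

/-- The value `χ(x)` as a complex number. -/
def charEval (χ : CharGroup G) (x : G) : ℂ := (χ (Multiplicative.ofAdd x) : ℂ)

lemma norm_charEval (χ : CharGroup G) (x : G) : ‖charEval χ x‖ = 1 :=
  Circle.norm_coe _

lemma charEval_inv (χ : CharGroup G) (x : G) : charEval χ⁻¹ x = charEval χ (-x) := by
  have h : χ⁻¹ (Multiplicative.ofAdd x) = χ (Multiplicative.ofAdd (-x)) := by
    rw [ofAdd_neg, map_inv]; rfl
  simp [charEval, h]

variable [ProperSpace G]

/-- The (inverse) Fourier transform `x ↦ ∫_Ĝ F(χ) χ(x) dχ` of a function `F` on the dual group,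
with respect to Haar measure. The Fourier algebra `A(G)` consists of the functions `dualFourier F`
with `F ∈ L¹(Ĝ)`, and `‖dualFourier F‖_A = ‖F‖₁`. -/
def dualFourier (F : CharGroup G → ℂ) (x : G) : ℂ :=
  ∫ χ, F χ * charEval χ x ∂(Measure.haar : Measure (CharGroup G))

/-- `‖F‖₁`, the norm of `dualFourier F` in the Fourier algebra. -/
def dualNorm (F : CharGroup G → ℂ) : ℝ := ∫ χ, ‖F χ‖ ∂(Measure.haar : Measure (CharGroup G))

/-! ### The Segal algebra `S₀(G)` -/

/-- `f = ∑ₙ T_{xₙ} fₙ` with `fₙ = dualFourier (F n)` in the Fourier algebra `A(G)`, every `fₙ`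
supported in the closed unit ball `Q` of `G` (a compact neighbourhood of zero), and
`∑ₙ ‖fₙ‖_A < ∞`. The series converges absolutely at every point, since `|fₙ| ≤ ‖fₙ‖_A`. -/
structure IsS0Decomp (f : G → ℂ) (x : ℕ → G) (F : ℕ → CharGroup G → ℂ) : Prop where
  integrable : ∀ n, Integrable (F n) (Measure.haar : Measure (CharGroup G))
  support : ∀ n, Function.support (dualFourier (F n)) ⊆ closedBall (0 : G) 1
  summable : Summable fun n => dualNorm (F n)
  hasSum : ∀ y, HasSum (fun n => dualFourier (F n) (y - x n)) (f y)

lemma dualNorm_nonneg (F : CharGroup G → ℂ) : 0 ≤ dualNorm F :=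
  integral_nonneg fun _ => norm_nonneg _

lemma norm_dualFourier_le (F : CharGroup G → ℂ) (x : G) : ‖dualFourier F x‖ ≤ dualNorm F := by
  refine (norm_integral_le_integral_norm _).trans (le_of_eq ?_)
  simp [dualNorm, norm_charEval]

lemma dualFourier_smul (c : ℂ) (F : CharGroup G → ℂ) (x : G) :
    dualFourier (fun χ => c * F χ) x = c * dualFourier F x := by
  simp only [dualFourier, mul_assoc]
  exact integral_const_mul _ _

lemma dualNorm_smul (c : ℂ) (F : CharGroup G → ℂ) :
    dualNorm (fun χ => c * F χ) = ‖c‖ * dualNorm F := by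
  simp only [dualNorm, norm_mul]
  exact integral_const_mul _ _

lemma dualFourier_inv (F : CharGroup G → ℂ) (x : G) :
    dualFourier (fun χ => F χ⁻¹) x = dualFourier F (-x) := by
  have h := integral_inv_eq_self (fun χ : CharGroup G => F χ * charEval χ (-x)) Measure.haar
  rw [dualFourier, dualFourier, ← h]
  simp [charEval_inv]

lemma dualNorm_inv (F : CharGroup G → ℂ) : dualNorm (fun χ => F χ⁻¹) = dualNorm F :=
  integral_inv_eq_self (fun χ : CharGroup G => ‖F χ‖) Measure.haar

namespace IsS0Decomp
variable {f g : G → ℂ} {x y : ℕ → G} {F K : ℕ → CharGroup G → ℂ}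

lemma norm_le (h : IsS0Decomp f x F) (z : G) : ‖f z‖ ≤ ∑' n, dualNorm (F n) := by
  rw [← (h.hasSum z).tsum_eq]
  exact tsum_of_norm_bounded h.summable.hasSum fun n => norm_dualFourier_le _ _

lemma zero : IsS0Decomp (0 : G → ℂ) (fun _ => 0) (fun _ _ => 0) where
  integrable _ := integrable_zero _ _ _
  support _ := by intro z hz; simp [dualFourier] at hz
  summable := by simp [dualNorm]
  hasSum z := by simp [dualFourier]

lemma smul (c : ℂ) (h : IsS0Decomp f x F) :
    IsS0Decomp (c • f) x (fun n χ => c * F n χ) where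
  integrable n := (h.integrable n).const_mul c
  support n := by
    intro z hz
    apply h.support n
    intro h0
    exact hz (by rw [dualFourier_smul, h0, mul_zero])
  summable := by simpa only [dualNorm_smul] using h.summable.mul_left ‖c‖
  hasSum z := by
    simp only [dualFourier_smul]
    exact (h.hasSum z).mul_left c

lemma add (hf : IsS0Decomp f x F) (hg : IsS0Decomp g y K) :
    IsS0Decomp (f + g) (fun n => Sum.elim x y (Equiv.natSumNatEquivNat.symm n))
      (fun n => Sum.elim F K (Equiv.natSumNatEquivNat.symm n)) where
  integrable n := by
    rcases Equiv.natSumNatEquivNat.symm n with i | i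
    exacts [hf.integrable i, hg.integrable i]
  support n := by
    rcases Equiv.natSumNatEquivNat.symm n with i | i
    exacts [hf.support i, hg.support i]
  summable := by
    refine (Equiv.summable_iff Equiv.natSumNatEquivNat.symm
      (f := fun i => dualNorm (Sum.elim F K i))).2 ?_
    exact (HasSum.sum (f := fun i => dualNorm (Sum.elim F K i)) hf.summable.hasSum
      hg.summable.hasSum).summable
  hasSum z := by
    refine (Equiv.hasSum_iff Equiv.natSumNatEquivNat.symm
      (f := fun i => dualFourier (Sum.elim F K i) (z - Sum.elim x y i))).2 ?_
    exact HasSum.sum (f := fun i => dualFourier (Sum.elim F K i) (z - Sum.elim x y i))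
      (hf.hasSum z) (hg.hasSum z)

lemma tsum_add (hf : IsS0Decomp f x F) (hg : IsS0Decomp g y K) :
    ∑' n, dualNorm (Sum.elim F K (Equiv.natSumNatEquivNat.symm n)) =
      ∑' n, dualNorm (F n) + ∑' n, dualNorm (K n) := by
  rw [Equiv.tsum_eq Equiv.natSumNatEquivNat.symm (fun i => dualNorm (Sum.elim F K i))]
  exact (HasSum.sum (f := fun i => dualNorm (Sum.elim F K i)) hf.summable.hasSum
      hg.summable.hasSum).tsum_eq

lemma translate (a : G) (h : IsS0Decomp f x F) :
    IsS0Decomp (fun z => f (z - a)) (fun n => x n + a) F where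
  integrable := h.integrable
  support := h.support
  summable := h.summable
  hasSum z := by simpa [sub_sub, add_comm] using h.hasSum (z - a)

lemma reflect (h : IsS0Decomp f x F) :
    IsS0Decomp (fun z => f (-z)) (fun n => - x n) (fun n χ => F n χ⁻¹) where
  integrable n := (h.integrable n).comp_inv
  support n := by
    intro z hz
    have := h.support n (show -z ∈ _ by
      rwa [Function.mem_support, dualFourier_inv] at hz)
    simpa using this
  summable := by simpa only [dualNorm_inv] using h.summable
  hasSum z := by
    simp only [dualFourier_inv]
    convert h.hasSum (-z) using 3
    abel

end IsS0Decomp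

end

/-- The functions on `G` that belong to `S₀(G)`. -/
def s0Submodule (G : Type) [NormedAddCommGroup G] [ProperSpace G] : Submodule ℂ (G → ℂ) where
  carrier := {f | ∃ x F, IsS0Decomp f x F}
  add_mem' := by
    rintro f g ⟨x, F, hf⟩ ⟨y, K, hg⟩
    exact ⟨_, _, hf.add hg⟩
  zero_mem' := ⟨_, _, IsS0Decomp.zero⟩
  smul_mem' := by
    rintro c f ⟨x, F, hf⟩
    exact ⟨_, _, hf.smul c⟩

/-- Feichtinger's algebra `S₀(G)`: the space of all sums `∑ₙ T_{xₙ} fₙ` of translates of functions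
`fₙ` in the Fourier algebra `A(G)` supported in the closed unit ball, with `∑ₙ ‖fₙ‖_A < ∞`.
Here `G` is an abelian group with an invariant metric in which closed balls are compact, such as
`ℝ^d` or any closed subgroup of `ℝ^d`. (Another compact neighbourhood of zero in place of
the closed unit ball gives the same space with an equivalent norm.) -/
def S0 (G : Type) [NormedAddCommGroup G] [ProperSpace G] : Type := s0Submodule G

namespace S0
variable {G : Type} [NormedAddCommGroup G] [ProperSpace G]

instance : AddCommGroup (S0 G) := inferInstanceAs (AddCommGroup (s0Submodule G))
instance : Module ℂ (S0 G) := inferInstanceAs (Module ℂ (s0Submodule G))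
instance : FunLike (S0 G) G ℂ where
  coe f := f.1
  coe_injective _ _ h := Subtype.ext h

lemma add_apply (f g : S0 G) (x : G) : (f + g) x = f x + g x := rfl
lemma smul_apply (c : ℂ) (f : S0 G) (x : G) : (c • f) x = c * f x := rfl

/-- The norm of `S₀(G)`: the infimum of `∑ₙ ‖fₙ‖_A` over all representations
`f = ∑ₙ T_{xₙ} fₙ`. -/
instance : Norm (S0 G) where
  norm f := sInf {r : ℝ | ∃ x F, IsS0Decomp (f : G → ℂ) x F ∧ r = ∑' n, dualNorm (F n)}

lemma norm_le_of_decomp {f : S0 G} {x : ℕ → G} {F : ℕ → CharGroup G → ℂ}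
    (h : IsS0Decomp (f : G → ℂ) x F) : ‖f‖ ≤ ∑' n, dualNorm (F n) :=
  csInf_le ⟨0, by rintro r ⟨x, F, -, rfl⟩; exact tsum_nonneg fun _ => dualNorm_nonneg _⟩
    ⟨x, F, h, rfl⟩

lemma le_norm {f : S0 G} {a : ℝ}
    (h : ∀ x F, IsS0Decomp (f : G → ℂ) x F → a ≤ ∑' n, dualNorm (F n)) : a ≤ ‖f‖ := by
  obtain ⟨x, F, hF⟩ := f.2
  refine le_csInf ⟨_, x, F, hF, rfl⟩ ?_
  rintro r ⟨x, F, hF, rfl⟩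
  exact h x F hF

lemma norm_apply_le (f : S0 G) (z : G) : ‖f z‖ ≤ ‖f‖ := le_norm fun _ _ h => h.norm_le z

lemma norm_smul_le' (c : ℂ) (f : S0 G) : ‖c • f‖ ≤ ‖c‖ * ‖f‖ := by
  rcases eq_or_ne c 0 with rfl | hc
  · have h : IsS0Decomp (((0 : ℂ) • f : S0 G) : G → ℂ) (fun _ => 0) (fun _ _ => 0) := by
      rw [zero_smul]; exact IsS0Decomp.zero
    simpa [dualNorm] using norm_le_of_decomp h
  · have hc' : 0 < ‖c‖ := norm_pos_iff.2 hc
    rw [← div_le_iff₀' hc']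
    refine le_norm fun x F h => ?_
    rw [div_le_iff₀' hc', ← tsum_mul_left]
    simpa only [dualNorm_smul] using norm_le_of_decomp (f := c • f) (h.smul c)

variable (G) in
lemma core : NormedSpace.Core ℂ (S0 G) where
  norm_nonneg f := le_norm fun _ _ _ => tsum_nonneg fun _ => dualNorm_nonneg _
  norm_smul c f := by
    refine le_antisymm (norm_smul_le' c f) ?_
    rcases eq_or_ne c 0 with rfl | hc
    · rw [norm_zero, zero_mul]
      exact le_norm fun _ _ _ => tsum_nonneg fun _ => dualNorm_nonneg _
    · have h := norm_smul_le' c⁻¹ (c • f)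
      rw [smul_smul, inv_mul_cancel₀ hc, one_smul, norm_inv] at h
      rwa [inv_mul_eq_div, le_div_iff₀' (norm_pos_iff.2 hc)] at h
  norm_triangle f g := by
    suffices h : ‖f + g‖ - ‖g‖ ≤ ‖f‖ by linarith
    refine le_norm fun x F hf => ?_
    suffices h : ‖f + g‖ - ∑' n, dualNorm (F n) ≤ ‖g‖ by linarith
    refine le_norm fun y K hg => ?_
    have h := norm_le_of_decomp (f := f + g) (hf.add hg)
    rw [hf.tsum_add hg] at h
    linarith
  norm_eq_zero_iff f := by
    constructor
    · intro h
      refine DFunLike.ext _ _ fun z => ?_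
      have := norm_apply_le f z
      rw [h] at this
      exact norm_le_zero_iff.1 this
    · rintro rfl
      refine le_antisymm ?_ (le_norm fun _ _ _ => tsum_nonneg fun _ => dualNorm_nonneg _)
      simpa [dualNorm] using norm_le_of_decomp (f := (0 : S0 G)) IsS0Decomp.zero

instance : NormedAddCommGroup (S0 G) := NormedAddCommGroup.ofCore (core G)
instance : NormedSpace ℂ (S0 G) := NormedSpace.ofCore (core G)

/-- The translate `T_a f = f(· - a)`. -/
def translate (a : G) (f : S0 G) : S0 G :=
  ⟨fun z => f (z - a), by obtain ⟨x, F, h⟩ := f.2; exact ⟨_, _, h.translate a⟩⟩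

/-- The reflection `f^✓ = f(-·)`. -/
def reflect (f : S0 G) : S0 G :=
  ⟨fun z => f (-z), by obtain ⟨x, F, h⟩ := f.2; exact ⟨_, _, h.reflect⟩⟩

/-- The Dirac measure `δ_x`, as an element of the dual space `S₀'(G)`. -/
def dirac (x : G) : StrongDual ℂ (S0 G) :=
  LinearMap.mkContinuous
    { toFun := fun f => f x, map_add' := fun _ _ => rfl, map_smul' := fun _ _ => rfl } 1
    fun f => by rw [one_mul]; exact norm_apply_le f x

/-- The convolution `σ ∗ φ` of `σ ∈ S₀'(G)` with `φ ∈ S₀(G)`: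
`(σ ∗ φ)(x) = σ(T_x φ^✓) = σ(φ(x - ·))`. -/
def conv (σ : StrongDual ℂ (S0 G)) (φ : S0 G) (x : G) : ℂ := σ (translate x (reflect φ))

end S0

/-! ### Subgroups and coordinates -/

instance instProperSpaceClosedAddSubgroup {G : Type} [NormedAddCommGroup G] [ProperSpace G]
    (H : AddSubgroup G) [h : IsClosed (H : Set G)] : ProperSpace H :=
  ProperSpace.of_isClosed h

/-- `ℝ^n` with the Euclidean norm. -/
abbrev Euc (n : ℕ) : Type := EuclideanSpace ℝ (Fin n)

/-- The first `k` coordinates of a point of `ℝ^d`, where `d = k + m`. -/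
def headCoords {k m d : ℕ} (h : k + m = d) (x : Euc d) : Euc k :=
  WithLp.toLp 2 fun i => x (Fin.cast h (Fin.castAdd m i))

/-- The last `m` coordinates of a point of `ℝ^d`, where `d = k + m`. -/
def tailCoords {k m d : ℕ} (h : k + m = d) (x : Euc d) : Euc m :=
  WithLp.toLp 2 fun i => x (Fin.cast h (Fin.natAdd k i))

/-- The projective tensor product `S₀(ℝ^k) ⊗̂ S₀(ℝ^m)`: the completion of the algebraic tensor
product over `ℂ` with respect to the projective tensor norm (the norm that Mathlib puts on
`⨂[ℂ] i, E i`). -/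
abbrev ProjTensorS0 (k m : ℕ) : Type :=
  UniformSpace.Completion (⨂[ℂ] i : Fin 2, S0 (Euc (![k, m] i)))

/-- The elementary tensor `f ⊗ g` in `S₀(ℝ^k) ⊗̂ S₀(ℝ^m)`. -/
def elemTensor {k m : ℕ} (f : S0 (Euc k)) (g : S0 (Euc m)) : ProjTensorS0 k m :=
  ((PiTensorProduct.tprod ℂ
    (Fin.cons f (Fin.cons g finZeroElim) : ∀ i : Fin 2, S0 (Euc (![k, m] i))) :
      ⨂[ℂ] i : Fin 2, S0 (Euc (![k, m] i))) : ProjTensorS0 k m)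

/-- The point of `ℝ^d` with integer coordinates `n`. -/
def intPoint {d : ℕ} (n : Fin d → ℤ) : Euc d := WithLp.toLp 2 fun i => (n i : ℝ)

end

/-! Everything rests on one atomic expansion: `S0 (Euc d)` is a complemented subspace of an `ℓ¹`
space, in a way compatible with restriction and with tensor products. Cut a function on `ℝ^d` by a
smooth partition of unity into small boxes, expand each piece in a Fourier series on a slightly
larger box, and cut back with a plateau. The atoms are modulated translates of a single bump. For an
exponential the coefficients are samples of a Schwartz function, so they are absolutely summable
uniformly in the frequency (`exists_expCoeff_bound`). An element of the Fourier algebra is an `L¹`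
superposition of exponentials, so its coefficients at each position are bounded by its norm. If it
lives in a unit ball, only a fixed number of positions matter. Hence the coefficients of `f` have
`ℓ¹` norm at most `C * ‖f‖` (`S0.exists_coeff_bound`) and they reproduce `f`
(`S0.hasSum_coeff_mul_boxAtom`). Conversely the atoms are bounded in `S0`, which is complete, so
`ℓ¹` combinations of them converge (`exists_clm_hasSum_smul`). Restriction to a closed subgroup `H`:
the atoms restrict to a bounded family in `S0 H`, because integrable functions on `ℝ^d` push forward
to integrable functions on the dual of `H` (`FreqEmbedding.exists_dualFourier`). For surjectivity,
`H` is a vector space plus a discrete group, so frequencies can be chosen measurably for its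
characters (`exists_freqEmbedding_closed`); a function in the Fourier algebra of `H` then becomes
the Fourier transform of a finite measure on `ℝ^d`, and finitely many of its boxes extend it from
the unit ball (`FreqEmbedding.exists_extension`). Tensor products: atoms on `ℝ^(k+m)` are products
of atoms and coefficients multiply, so the isomorphism reflects that the projective tensor product
of two `ℓ¹` spaces is `ℓ¹` of the product index set. Samples are summable because a unit ball
contains a bounded number of lattice points. The lattice extension is an `ℓ¹` combination of
translates of norm at most `‖φ‖`. -/

noncomputable section

/-! ### Absolutely convergent series -/

namespace S0
variable {G : Type} [NormedAddCommGroup G] [ProperSpace G]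

lemma exists_decomp_of_norm_lt {f : S0 G} {b : ℝ} (h : ‖f‖ < b) :
    ∃ x F, IsS0Decomp (f : G → ℂ) x F ∧ ∑' n, dualNorm (F n) < b := by
  have hne : {r : ℝ | ∃ x F, IsS0Decomp (f : G → ℂ) x F ∧ r = ∑' n, dualNorm (F n)}.Nonempty := by
    obtain ⟨x, F, hF⟩ := f.2
    exact ⟨_, x, F, hF, rfl⟩
  obtain ⟨r, ⟨x, F, hF, rfl⟩, hr⟩ := exists_lt_of_csInf_lt hne h
  exact ⟨x, F, hF, hr⟩

/-- The element of `S₀(G)` given by a decomposition. -/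
def ofDecomp {f : G → ℂ} {x : ℕ → G} {F : ℕ → CharGroup G → ℂ} (h : IsS0Decomp f x F) : S0 G :=
  ⟨f, x, F, h⟩

lemma norm_ofDecomp_le {f : G → ℂ} {x : ℕ → G} {F : ℕ → CharGroup G → ℂ}
    (h : IsS0Decomp f x F) : ‖ofDecomp h‖ ≤ ∑' n, dualNorm (F n) :=
  norm_le_of_decomp (f := ofDecomp h) h

/-- A series of elements of `S₀(G)` with summable norms can be summed pointwise. -/
lemma exists_hasSum_apply {f : ℕ → S0 G} {b : ℕ → ℝ} (hf : ∀ n, ‖f n‖ < b n) (hb : Summable b) :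
    ∃ g : S0 G, (∀ z, HasSum (fun n => f n z) (g z)) ∧ ‖g‖ ≤ ∑' n, b n := by
  -- The strict bound leaves room for a decomposition of `f n` that costs less than `b n`; all of
  -- them are then merged into one sequence.
  choose x F hF hlt using fun n => exists_decomp_of_norm_lt (hf n)
  have hsum : Summable fun p : ℕ × ℕ => dualNorm (F p.1 p.2) := by
    rw [summable_prod_of_nonneg fun p => dualNorm_nonneg _]
    exact ⟨fun n => (hF n).summable, hb.of_nonneg_of_le
      (fun n => tsum_nonneg fun _ => dualNorm_nonneg _) fun n => (hlt n).le⟩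
  have hpt : ∀ z, Summable fun p : ℕ × ℕ => dualFourier (F p.1 p.2) (z - x p.1 p.2) := fun z =>
    hsum.of_norm_bounded fun p => norm_dualFourier_le _ _
  have hz : ∀ z, HasSum (fun n => f n z)
      (∑' p : ℕ × ℕ, dualFourier (F p.1 p.2) (z - x p.1 p.2)) := fun z =>
    (hpt z).hasSum.prod_fiberwise fun n => (hF n).hasSum z
  obtain ⟨e⟩ : Nonempty (ℕ ≃ ℕ × ℕ) := ⟨Nat.pairEquiv.symm⟩
  have hdec : IsS0Decomp (fun z => ∑' p : ℕ × ℕ, dualFourier (F p.1 p.2) (z - x p.1 p.2))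
      (fun n => x (e n).1 (e n).2) (fun n => F (e n).1 (e n).2) :=
    { integrable := fun n => (hF _).integrable _
      support := fun n => (hF _).support _
      summable := e.summable_iff.2 hsum
      hasSum := fun z => e.hasSum_iff.2 (hpt z).hasSum }
  refine ⟨ofDecomp hdec, hz, (norm_ofDecomp_le hdec).trans ?_⟩
  rw [e.tsum_eq (fun p => dualNorm (F p.1 p.2)),
    hsum.tsum_prod' fun n => (hF n).summable]
  refine Summable.tsum_le_tsum (fun n => (hlt n).le) ?_ hb
  exact ((summable_prod_of_nonneg fun p => dualNorm_nonneg _).1 hsum).2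

/-- Absolutely convergent series converge: the pointwise sum lies in `S0 G`, and the same
construction applied to the tail bounds the remainder. The geometric term in `b` only makes the norm
bounds strict. -/
instance : CompleteSpace (S0 G) := by
  refine NormedAddCommGroup.completeSpace_of_summable_imp_tendsto fun u hu => ?_
  let b : ℕ → ℝ := fun n => ‖u n‖ + (1 / 2) ^ n
  have hb : Summable b := hu.add summable_geometric_two
  have hlt : ∀ n, ‖u n‖ < b n := fun n => by simp [b]
  obtain ⟨g, hg, -⟩ := exists_hasSum_apply hlt hb
  refine ⟨g, tendsto_iff_norm_sub_tendsto_zero.2 ?_⟩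
  refine squeeze_zero (fun _ => norm_nonneg _) (fun N => ?_) (tendsto_sum_nat_add b)
  obtain ⟨t, ht, hle⟩ := exists_hasSum_apply (f := fun n => u (n + N)) (b := fun n => b (n + N))
    (fun n => hlt _) ((summable_nat_add_iff N).2 hb)
  have heq : g - ∑ i ∈ Finset.range N, u i = t := by
    rw [sub_eq_iff_eq_add']
    refine DFunLike.ext _ _ fun z => ?_
    have hev : (∑ i ∈ Finset.range N, u i) z = ∑ i ∈ Finset.range N, u i z :=
      map_sum (dirac z) _ _
    rw [add_apply, hev]
    exact (hg z).unique ((hasSum_nat_add_iff' N).1 (by simpa using ht z))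
  rw [norm_sub_rev, heq]
  exact hle

lemma hasSum_apply {ι : Type*} {f : ι → S0 G} {g : S0 G} (h : HasSum f g) (z : G) :
    HasSum (fun i => f i z) (g z) := h.mapL (dirac z)

lemma norm_translate_le (a : G) (f : S0 G) : ‖translate a f‖ ≤ ‖f‖ :=
  le_norm fun _ _ h => norm_le_of_decomp (f := translate a f) (h.translate a)

lemma norm_dirac_le (x : G) : ‖dirac x‖ ≤ 1 := LinearMap.mkContinuous_norm_le _ zero_le_one _

end S0

/-- Absolutely summable coefficient functionals and a bounded family of vectors define a bounded
operator. -/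
lemma exists_clm_hasSum_smul {X E ι : Type*} [NormedAddCommGroup X] [NormedSpace ℂ X]
    [NormedAddCommGroup E] [NormedSpace ℂ E] [CompleteSpace E] (c : ι → X →ₗ[ℂ] ℂ) {C B : ℝ}
    (hs : ∀ f, Summable fun i => ‖c i f‖) (hC : ∀ f, ∑' i, ‖c i f‖ ≤ C * ‖f‖)
    {v : ι → E} (hB : 0 ≤ B) (hv : ∀ i, ‖v i‖ ≤ B) :
    ∃ T : X →L[ℂ] E, ∀ f, HasSum (fun i => c i f • v i) (T f) := by
  have hle : ∀ f i, ‖c i f • v i‖ ≤ ‖c i f‖ * B := fun f i => by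
    rw [norm_smul]; gcongr; exact hv i
  have hsum : ∀ f, Summable fun i => c i f • v i := fun f =>
    ((hs f).mul_right B).of_norm_bounded (hle f)
  let T : X →ₗ[ℂ] E :=
    { toFun := fun f => ∑' i, c i f • v i
      map_add' := fun f g => by
        simp only [map_add, add_smul]
        exact (hsum f).tsum_add (hsum g)
      map_smul' := fun a f => by
        simp only [map_smul, smul_assoc, RingHom.id_apply]
        exact (hsum f).tsum_const_smul a }
  refine ⟨T.mkContinuous (C * B) fun f => ?_, fun f => (hsum f).hasSum⟩
  refine (tsum_of_norm_bounded ((hs f).mul_right B).hasSum (hle f)).trans ?_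
  rw [tsum_mul_right, mul_right_comm]
  gcongr
  exact hC f

/-! ### Products of series -/

section
variable {ι R : Type*} [NormedField R]

lemma summable_norm_pi_prod : ∀ {d : ℕ} {f : Fin d → ι → R}, (∀ j, Summable fun i => ‖f j i‖) →
    Summable fun i : Fin d → ι => ‖∏ j, f j (i j)‖
  | 0, f, _ => Summable.of_finite
  | d + 1, f, h => by
    rw [← (Fin.consEquiv fun _ => ι).summable_iff]
    have h1 := (h 0).mul_norm (summable_norm_pi_prod fun j => h j.succ)
    simpa [Function.comp_def, Fin.prod_univ_succ] using h1

lemma hasSum_pi_prod [CompleteSpace R] : ∀ {d : ℕ} {f : Fin d → ι → R},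
    (∀ j, Summable fun i => ‖f j i‖) →
    HasSum (fun i : Fin d → ι => ∏ j, f j (i j)) (∏ j, ∑' i, f j i)
  | 0, f, _ => by simp [hasSum_unique]
  | d + 1, f, h => by
    rw [← (Fin.consEquiv fun _ => ι).hasSum_iff, Fin.prod_univ_succ]
    have ih := hasSum_pi_prod fun j => h j.succ
    have h2 := summable_norm_pi_prod fun j => h (Fin.succ j)
    have h1 := summable_mul_of_summable_norm (h 0) h2
    have h3 := (h 0).of_norm.hasSum.mul ih h1
    simpa [Function.comp_def, Fin.prod_univ_succ] using h3

end
end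

noncomputable section

/-! ### A local Fourier expansion on the line -/

open scoped FourierTransform SchwartzMap ContDiff

/-- `e^{2πit}` -/
def unitExp (t : ℝ) : ℂ := (𝐞 t : ℂ)

lemma unitExp_add (s t : ℝ) : unitExp (s + t) = unitExp s * unitExp t := by
  simp [unitExp, AddChar.map_add_eq_mul]

@[simp] lemma unitExp_zero : unitExp 0 = 1 := by simp [unitExp]

@[simp] lemma norm_unitExp (t : ℝ) : ‖unitExp t‖ = 1 := Circle.norm_coe _

lemma unitExp_eq (t : ℝ) : unitExp t = Complex.exp (↑(2 * Real.pi * t) * Complex.I) :=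
  Real.fourierChar_apply t

@[fun_prop] lemma contDiff_unitExp : ContDiff ℝ ∞ unitExp := by
  have : unitExp = fun t : ℝ => Complex.exp (↑(2 * Real.pi * t) * Complex.I) :=
    funext unitExp_eq
  rw [this]
  exact ((Complex.ofRealCLM.contDiff.comp (contDiff_const.mul contDiff_id)).mul
    contDiff_const).cexp

@[fun_prop] lemma continuous_unitExp : Continuous unitExp := contDiff_unitExp.continuous

@[fun_prop] lemma measurable_unitExp : Measurable unitExp := continuous_unitExp.measurable

lemma unitExp_sum {ι : Type*} (s : Finset ι) (f : ι → ℝ) :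
    unitExp (∑ i ∈ s, f i) = ∏ i ∈ s, unitExp (f i) := by
  classical
  induction s using Finset.induction_on with
  | empty => simp
  | insert a s ha ih => rw [Finset.sum_insert ha, Finset.prod_insert ha, unitExp_add, ih]

/-- A smooth function supported in `[-1/4, 1/4]` whose translates by `ℤ/4` add up to one. -/
def cutoff (x : ℝ) : ℝ := Real.smoothTransition (4 * x + 1) - Real.smoothTransition (4 * x)

/-- A smooth function supported in `[-1/2, 1/2]` that is one on `[-1/4, 1/4]`. -/
def plateau (x : ℝ) : ℝ := Real.smoothTransition (2 - 4 * x) * Real.smoothTransition (2 + 4 * x)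

@[fun_prop] lemma contDiff_cutoff : ContDiff ℝ ∞ cutoff :=
  (Real.smoothTransition.contDiff.comp ((contDiff_const.mul contDiff_id).add contDiff_const)).sub
    (Real.smoothTransition.contDiff.comp (contDiff_const.mul contDiff_id))

@[fun_prop] lemma continuous_cutoff : Continuous cutoff := contDiff_cutoff.continuous

@[fun_prop] lemma contDiff_plateau : ContDiff ℝ ∞ plateau :=
  (Real.smoothTransition.contDiff.comp (contDiff_const.sub (contDiff_const.mul contDiff_id))).mul
    (Real.smoothTransition.contDiff.comp (contDiff_const.add (contDiff_const.mul contDiff_id)))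

lemma cutoff_eq_zero {x : ℝ} (h : 1 / 4 ≤ |x|) : cutoff x = 0 := by
  rcases le_abs.1 h with h | h
  · rw [cutoff, Real.smoothTransition.one_of_one_le (by linarith),
      Real.smoothTransition.one_of_one_le (by linarith), sub_self]
  · rw [cutoff, Real.smoothTransition.zero_of_nonpos (by linarith),
      Real.smoothTransition.zero_of_nonpos (by linarith), sub_self]

lemma plateau_eq_zero {x : ℝ} (h : 1 / 2 ≤ |x|) : plateau x = 0 := by
  rcases le_abs.1 h with h | h
  · rw [plateau, Real.smoothTransition.zero_of_nonpos (by linarith), zero_mul]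
  · rw [plateau, Real.smoothTransition.zero_of_nonpos (x := 2 + 4 * x) (by linarith), mul_zero]

lemma plateau_eq_one {x : ℝ} (h : |x| ≤ 1 / 4) : plateau x = 1 := by
  obtain ⟨h1, h2⟩ := abs_le.1 h
  rw [plateau, Real.smoothTransition.one_of_one_le (by linarith),
      Real.smoothTransition.one_of_one_le (by linarith), mul_one]

lemma abs_plateau_le (x : ℝ) : |plateau x| ≤ 1 := by
  rw [plateau, abs_mul, abs_of_nonneg (Real.smoothTransition.nonneg _),
    abs_of_nonneg (Real.smoothTransition.nonneg _)]
  exact mul_le_one₀ (Real.smoothTransition.le_one _) (Real.smoothTransition.nonneg _)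
    (Real.smoothTransition.le_one _)

lemma cutoff_sub_ne_zero_iff_mem {x : ℝ} {k : ℤ} (h : cutoff (x - k / 4) ≠ 0) :
    k = ⌊4 * x⌋ ∨ k = ⌊4 * x⌋ + 1 := by
  have h1 : |x - k / 4| < 1 / 4 := by
    by_contra h2
    exact h (cutoff_eq_zero (not_lt.1 h2))
  obtain ⟨h2, h3⟩ := abs_lt.1 h1
  have h4 := Int.floor_le (4 * x)
  have h5 := Int.lt_floor_add_one (4 * x)
  have h6 : (k : ℝ) < (⌊4 * x⌋ + 2 : ℤ) := by push_cast; linarith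
  have h7 : ((⌊4 * x⌋ - 1 : ℤ) : ℝ) < k := by push_cast; linarith
  have h8 : k < ⌊4 * x⌋ + 2 := by exact_mod_cast h6
  have h9 : ⌊4 * x⌋ - 1 < k := by exact_mod_cast h7
  omega

/-- A telescoping sum of smooth steps: only the indices `⌊4x⌋` and `⌊4x⌋ + 1` contribute, with
values `1 - s` and `s`. -/
lemma hasSum_cutoff (x : ℝ) : HasSum (fun k : ℤ => (cutoff (x - k / 4) : ℂ)) 1 := by
  have h : HasSum (fun k : ℤ => (cutoff (x - k / 4) : ℂ))
      (∑ k ∈ ({⌊4 * x⌋, ⌊4 * x⌋ + 1} : Finset ℤ), (cutoff (x - k / 4) : ℂ)) := by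
    refine hasSum_sum_of_ne_finset_zero fun k hk => ?_
    by_contra hne
    refine hk ?_
    simpa using cutoff_sub_ne_zero_iff_mem (fun h => hne (by simp [h]))
  convert h using 1
  rw [Finset.sum_pair (by simp)]
  have h4 := Int.floor_le (4 * x)
  have h5 := Int.lt_floor_add_one (4 * x)
  norm_cast
  simp only [cutoff]
  push_cast
  rw [Real.smoothTransition.one_of_one_le (by linarith : 1 ≤ 4 * (x - (⌊4 * x⌋ : ℝ) / 4) + 1),
    Real.smoothTransition.zero_of_nonpos
      (by linarith : 4 * (x - ((⌊4 * x⌋ : ℝ) + 1) / 4) ≤ 0),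
    show 4 * (x - ((⌊4 * x⌋ : ℝ) + 1) / 4) + 1 = 4 * (x - (⌊4 * x⌋ : ℝ) / 4) by ring]
  ring

lemma summable_norm_cutoff (x : ℝ) : Summable fun k : ℤ => ‖(cutoff (x - k / 4) : ℂ)‖ :=
  (hasSum_cutoff x).summable.norm

/-- `y ↦ φ(y - k/4) e^{-2πily}` -/
def window (k l : ℤ) (y : ℝ) : ℂ := cutoff (y - k / 4) * unitExp (-(l * y))

/-- `x ↦ ψ(x - k/4) e^{2πilx}` -/
def lineAtom (k l : ℤ) (x : ℝ) : ℂ := plateau (x - k / 4) * unitExp (l * x)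

/-- The coefficient of `y ↦ e^{2πiξy}` with respect to the window with indices `k, l`. -/
def expCoeff (k l : ℤ) (ξ : ℝ) : ℂ := ∫ y, unitExp (ξ * y) * window k l y

lemma hasCompactSupport_cutoff (a : ℝ) : HasCompactSupport fun y => cutoff (y - a) := by
  refine HasCompactSupport.intro (K := Set.Icc (a - 1 / 4) (a + 1 / 4)) isCompact_Icc
    fun y hy => cutoff_eq_zero ?_
  by_contra h
  obtain ⟨h1, h2⟩ := abs_lt.1 (not_le.1 h)
  exact hy ⟨by linarith, by linarith⟩

/-- A modulated translate of the cutoff function, as a Schwartz function. -/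
def cutoffSchwartz (a ξ : ℝ) : 𝓢(ℝ, ℂ) :=
  HasCompactSupport.toSchwartzMap (f := fun y => (cutoff (y - a) : ℂ) * unitExp (ξ * y))
    (((hasCompactSupport_cutoff a).comp_left (g := Complex.ofReal) rfl).mul_right)
    ((Complex.ofRealCLM.contDiff.comp (contDiff_cutoff.comp (contDiff_id.sub contDiff_const))).mul
      (contDiff_unitExp.comp (contDiff_const.mul contDiff_id)))

lemma cutoffSchwartz_apply (a ξ y : ℝ) :
    cutoffSchwartz a ξ y = (cutoff (y - a) : ℂ) * unitExp (ξ * y) := rfl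

lemma fourier_cutoffSchwartz (a ξ w : ℝ) : 𝓕 (cutoffSchwartz a ξ) w =
    ∫ y, unitExp (ξ * y) * (cutoff (y - a) * unitExp (-(w * y))) := by
  rw [SchwartzMap.fourier_coe, Real.fourier_real_eq]
  refine integral_congr_ae (.of_forall fun y => ?_)
  simp only [cutoffSchwartz_apply, Circle.smul_def, smul_eq_mul, unitExp]
  rw [mul_comm y w]
  ring

lemma expCoeff_eq_fourier (k l : ℤ) (ξ : ℝ) :
    expCoeff k l ξ = 𝓕 (cutoffSchwartz (k / 4) ξ) l := by
  rw [fourier_cutoffSchwartz]; rfl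

/-- Moving the window to the origin costs only a phase, so the bound does not depend on the position
`k`. -/
lemma norm_expCoeff (k l : ℤ) (ξ : ℝ) :
    ‖expCoeff k l ξ‖ = ‖𝓕 (cutoffSchwartz 0 0) (l - ξ)‖ := by
  rw [expCoeff_eq_fourier, fourier_cutoffSchwartz, fourier_cutoffSchwartz,
    ← integral_add_right_eq_self _ ((k : ℝ) / 4)]
  have : ∀ y : ℝ, unitExp (ξ * (y + k / 4)) *
      (cutoff (y + k / 4 - k / 4) * unitExp (-(l * (y + k / 4)))) = unitExp ((ξ - l) * (k / 4)) *
      (unitExp (0 * y) * (cutoff (y - 0) * unitExp (-((l - ξ) * y)))) := fun y => by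
    rw [show ξ * (y + k / 4) = (ξ * (k / 4) + ξ * y : ℝ) by ring,
      show -((l : ℝ) * (y + k / 4)) = -(l * (k / 4)) + -(l * y) by ring,
      show (ξ - l) * ((k : ℝ) / 4) = ξ * (k / 4) + -(l * (k / 4)) by ring,
      show -((l - ξ) * y) = ξ * y + -(l * y) by ring]
    simp only [unitExp_add, add_sub_cancel_right, sub_zero, zero_mul, unitExp_zero]
    ring
  simp only [this]
  rw [integral_const_mul, norm_mul, norm_unitExp, one_mul]

/-- Replaces the real shift `ξ` by an integer, so that the sum over `l` becomes independent of `ξ`.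
The constant comes from `(u + v)² ≤ 2u² + 2v²` with `0 ≤ v < 1`. -/
lemma one_add_sq_le_of_floor (l : ℤ) (ξ : ℝ) :
    1 + ((l - ⌊ξ⌋ : ℤ) : ℝ) ^ 2 ≤ 3 * (1 + (l - ξ) ^ 2) := by
  have h1 := Int.floor_le ξ
  have h2 := Int.lt_floor_add_one ξ
  push_cast
  nlinarith [sq_nonneg ((l - ξ) - (ξ - ⌊ξ⌋))]

lemma summable_one_div_one_add_sq : Summable fun l : ℤ => 1 / (1 + (l : ℝ) ^ 2) := by
  -- The comparison fails only at `l = 0`, where `1 / l ^ 2` has the default value `0`.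
  refine Summable.of_norm_bounded_eventually (g := fun l : ℤ => 1 / (l : ℝ) ^ 2)
    (Real.summable_one_div_int_pow.2 one_lt_two) ?_
  refine (Set.finite_singleton (0 : ℤ)).subset fun l hl => ?_
  by_contra h0
  have h0' : (0 : ℝ) < (l : ℝ) ^ 2 := by
    have : (l : ℝ) ≠ 0 := by exact_mod_cast h0
    positivity
  refine hl ?_
  change ‖1 / (1 + (l : ℝ) ^ 2)‖ ≤ 1 / (l : ℝ) ^ 2
  rw [Real.norm_of_nonneg (by positivity)]
  exact one_div_le_one_div_of_le h0' (by linarith)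

/-- The coefficients of an exponential are absolutely summable for each window, uniformly in the
frequency and in the position of the window. -/
lemma exists_expCoeff_bound : ∃ A : ℝ, 0 ≤ A ∧ ∀ (k : ℤ) (ξ : ℝ),
    Summable (fun l => ‖expCoeff k l ξ‖) ∧ ∑' l, ‖expCoeff k l ξ‖ ≤ A := by
  -- Decay of orders `0` and `2` together gives a bound by a multiple of `1 / (1 + t²)`.
  obtain ⟨C0, hC0, h0⟩ := (𝓕 (cutoffSchwartz 0 0)).decay 0 0
  obtain ⟨C2, hC2, h2⟩ := (𝓕 (cutoffSchwartz 0 0)).decay 2 0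
  simp only [pow_zero, norm_iteratedFDeriv_zero, one_mul, Real.norm_eq_abs, sq_abs] at h0 h2
  have hb : ∀ (k l : ℤ) (ξ : ℝ), ‖expCoeff k l ξ‖ ≤
      3 * (C0 + C2) * (1 / (1 + ((l - ⌊ξ⌋ : ℤ) : ℝ) ^ 2)) := fun k l ξ => by
    rw [norm_expCoeff, mul_one_div, le_div_iff₀ (by positivity)]
    calc _ ≤ ‖𝓕 (cutoffSchwartz 0 0) (l - ξ)‖ * (3 * (1 + (l - ξ) ^ 2)) := by
          gcongr; exact one_add_sq_le_of_floor l ξ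
      _ = 3 * (‖𝓕 (cutoffSchwartz 0 0) (l - ξ)‖ +
            (l - ξ) ^ 2 * ‖𝓕 (cutoffSchwartz 0 0) (l - ξ)‖) := by ring
      _ ≤ _ := by gcongr; exacts [h0 _, h2 _]
  have hs : ∀ ξ : ℝ, HasSum (fun l : ℤ => 3 * (C0 + C2) * (1 / (1 + ((l - ⌊ξ⌋ : ℤ) : ℝ) ^ 2)))
      (3 * (C0 + C2) * ∑' l : ℤ, 1 / (1 + (l : ℝ) ^ 2)) := fun ξ =>
    ((Equiv.subRight ⌊ξ⌋).hasSum_iff.2 summable_one_div_one_add_sq.hasSum).mul_left _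
  refine ⟨3 * (C0 + C2) * ∑' l : ℤ, 1 / (1 + (l : ℝ) ^ 2), ?_, fun k ξ => ?_⟩
  · exact mul_nonneg (by positivity) (tsum_nonneg fun l => by positivity)
  · have h := (hs ξ).summable.of_nonneg_of_le (fun _ => norm_nonneg _) (hb k · ξ)
    exact ⟨h, (h.tsum_le_tsum (hb k · ξ) (hs ξ).summable).trans (hs ξ).tsum_eq.le⟩

/-- By Poisson summation, the Fourier series with coefficients `expCoeff k l ξ` is the
1-periodization of the cut-off exponential. The plateau is one where the cutoff lives and removes
all the other periods. -/
lemma hasSum_expCoeff_mul_lineAtom (k : ℤ) (ξ x : ℝ) :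
    HasSum (fun l => expCoeff k l ξ * lineAtom k l x)
      (cutoff (x - k / 4) * unitExp (ξ * x)) := by
  obtain ⟨A, -, hA⟩ := exists_expCoeff_bound
  have hf : ∀ l : ℤ, (fourier l (x : UnitAddCircle) : ℂ) = unitExp (l * x) := fun l => by
    rw [fourier_coe_apply, unitExp_eq]
    congr 1
    push_cast
    ring
  have hs : Summable fun l => expCoeff k l ξ * unitExp (l * x) :=
    (hA k ξ).1.of_norm_bounded fun l => by simp
  have hP := (cutoffSchwartz (k / 4) ξ).tsum_eq_tsum_fourier x
  simp only [← expCoeff_eq_fourier, hf] at hP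
  have h1 := (hs.hasSum.mul_left (plateau (x - k / 4) : ℂ))
  rw [← hP] at h1
  have e1 : (fun l => expCoeff k l ξ * lineAtom k l x) =
      fun l : ℤ => (plateau (x - k / 4) : ℂ) * (expCoeff k l ξ * unitExp (l * x)) := by
    funext l
    simp only [lineAtom]
    ring
  suffices hv : (cutoff (x - k / 4) : ℂ) * unitExp (ξ * x) =
      plateau (x - k / 4) * ∑' n : ℤ, cutoffSchwartz (k / 4) ξ (x + n) by
    rw [e1, hv]
    exact h1
  by_cases hx : 1 / 2 ≤ |x - k / 4|
  · rw [plateau_eq_zero hx, cutoff_eq_zero (by linarith)]; simp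
  rw [not_le, abs_lt] at hx
  -- Here `|x - k/4| < 1/2`, so a shift by a nonzero integer leaves the support of the cutoff.
  rw [tsum_eq_single 0]
  · by_cases hx' : 1 / 4 ≤ |x - k / 4|
    · simp [cutoffSchwartz_apply, cutoff_eq_zero hx']
    · simp [cutoffSchwartz_apply, plateau_eq_one (not_le.1 hx').le]
  · intro n hn
    rw [cutoffSchwartz_apply, cutoff_eq_zero]
    · simp
    · rcases lt_or_gt_of_ne hn with h | h
      · have : (n : ℝ) ≤ -1 := by exact_mod_cast Int.le_sub_one_of_lt h
        exact le_abs.2 (.inr (by linarith))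
      · have : (1 : ℝ) ≤ n := by exact_mod_cast h
        exact le_abs.2 (.inl (by linarith))

lemma integrable_window (k l : ℤ) : Integrable (window k l) := by
  have h := (cutoffSchwartz (k / 4) (-l)).integrable (μ := volume)
  refine h.congr (.of_forall fun y => ?_)
  simp [cutoffSchwartz_apply, window]

lemma continuous_window (k l : ℤ) : Continuous (window k l) := by
  unfold window; fun_prop

lemma continuous_expCoeff (k l : ℤ) : Continuous (expCoeff k l) := by
  refine continuous_of_dominated (bound := fun y => ‖window k l y‖)
    (fun ξ => ((by fun_prop : Continuous fun y => unitExp (ξ * y)).mul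
      (continuous_window k l)).aestronglyMeasurable) (fun ξ => .of_forall fun y => by simp)
    (integrable_window k l).norm (.of_forall fun y => by fun_prop)
end

noncomputable section

/-! ### Local Fourier expansions in several variables -/

section
variable {d : ℕ}

/-- Positions and frequencies of the atoms on `ℝ^d`. -/
abbrev AtomIndex (d : ℕ) : Type := (Fin d → ℤ) × (Fin d → ℤ)

/-- The product of the cutoff functions `x_j ↦ φ(N x_j - k_j/4)`. -/
def boxCutoff (N : ℝ) (k : Fin d → ℤ) (x : Euc d) : ℂ := ∏ j, (cutoff (N * x j - k j / 4) : ℂ)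

/-- The product of the atoms `x_j ↦ ψ(N x_j - k_j/4) e^{2πi l_j N x_j}`. -/
def boxAtom (N : ℝ) (i : AtomIndex d) (x : Euc d) : ℂ := ∏ j, lineAtom (i.1 j) (i.2 j) (N * x j)

/-- The window that computes the coefficient belonging to `boxAtom N i`. -/
def boxWindow (N : ℝ) (i : AtomIndex d) (y : Fin d → ℝ) : ℂ :=
  ∏ j, (N : ℂ) * window (i.1 j) (i.2 j) (N * y j)

/-- The coefficients of the exponential `x ↦ e^{2πi⟨ξ,x⟩}`. -/
def boxCoeff (N : ℝ) (i : AtomIndex d) (ξ : Euc d) : ℂ :=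
  ∏ j, expCoeff (i.1 j) (i.2 j) (ξ j / N)

lemma inner_euc (ξ x : Euc d) : inner ℝ ξ x = ∑ j, ξ j * x j := by
  simp [PiLp.inner_apply, mul_comm]

lemma exists_boxCoeff_bound (d : ℕ) : ∃ A : ℝ, 0 ≤ A ∧ ∀ (N : ℝ) (k : Fin d → ℤ) (ξ : Euc d),
    Summable (fun l => ‖boxCoeff N (k, l) ξ‖) ∧ ∑' l, ‖boxCoeff N (k, l) ξ‖ ≤ A := by
  obtain ⟨A, hA0, hA⟩ := exists_expCoeff_bound
  refine ⟨A ^ d, by positivity, fun N k ξ => ?_⟩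
  have hs : ∀ j, Summable fun l : ℤ => ‖expCoeff (k j) l (ξ j / N)‖ := fun j => (hA _ _).1
  refine ⟨summable_norm_pi_prod (f := fun j l => expCoeff (k j) l (ξ j / N)) hs, ?_⟩
  have h := hasSum_pi_prod (f := fun j l => ‖expCoeff (k j) l (ξ j / N)‖) (by simpa using hs)
  simp only [boxCoeff, norm_prod]
  rw [h.tsum_eq]
  calc _ ≤ ∏ j : Fin d, A :=
        Finset.prod_le_prod (fun j _ => tsum_nonneg fun _ => norm_nonneg _) fun j _ => (hA _ _).2
    _ = A ^ d := by simp

lemma norm_lineAtom_le (k l : ℤ) (x : ℝ) : ‖lineAtom k l x‖ ≤ 1 := by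
  simpa [lineAtom] using abs_plateau_le _

lemma norm_boxAtom_le (N : ℝ) (i : AtomIndex d) (x : Euc d) : ‖boxAtom N i x‖ ≤ 1 := by
  rw [boxAtom, norm_prod]
  exact Finset.prod_le_one (fun _ _ => norm_nonneg _) fun j _ => norm_lineAtom_le _ _ _

/-- The product of the expansions on the line. In the variable `N * x j` the exponential has
frequency `ξ j / N`. -/
lemma hasSum_boxCoeff_mul_boxAtom {N : ℝ} (hN : 0 < N) (k : Fin d → ℤ) (ξ x : Euc d) :
    HasSum (fun l => boxCoeff N (k, l) ξ * boxAtom N (k, l) x)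
      (boxCutoff N k x * unitExp (inner ℝ ξ x)) := by
  obtain ⟨A, -, hA⟩ := exists_expCoeff_bound
  have hs : ∀ j, Summable fun l : ℤ =>
      ‖expCoeff (k j) l (ξ j / N) * lineAtom (k j) l (N * x j)‖ := fun j =>
    (hA (k j) (ξ j / N)).1.of_nonneg_of_le (fun _ => norm_nonneg _) fun l => by
      rw [norm_mul]
      exact mul_le_of_le_one_right (norm_nonneg _) (norm_lineAtom_le _ _ _)
  have h := hasSum_pi_prod hs
  have hj : ∀ j, ∑' l : ℤ, expCoeff (k j) l (ξ j / N) * lineAtom (k j) l (N * x j) =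
      cutoff (N * x j - k j / 4) * unitExp (ξ j * x j) := fun j => by
    rw [(hasSum_expCoeff_mul_lineAtom _ _ _).tsum_eq]
    congr 2
    field_simp
  simp only [hj] at h
  simp only [boxCoeff, boxAtom, boxCutoff, inner_euc, unitExp_sum, ← Finset.prod_mul_distrib]
  exact h

lemma hasSum_boxCutoff (N : ℝ) (x : Euc d) : HasSum (fun k : Fin d → ℤ => boxCutoff N k x) 1 := by
  have h := hasSum_pi_prod (f := fun j (k : ℤ) => (cutoff (N * x j - k / 4) : ℂ))
    fun _ => summable_norm_cutoff _
  simp only [(hasSum_cutoff _).tsum_eq, Finset.prod_const_one] at h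
  exact h

lemma integrable_boxWindow {N : ℝ} (hN : 0 < N) (i : AtomIndex d) : Integrable (boxWindow N i) :=
  Integrable.fintype_prod (f := fun j y => (N : ℂ) * window (i.1 j) (i.2 j) (N * y))
    fun _ => ((integrable_window _ _).comp_mul_left' hN.ne').const_mul _

lemma continuous_boxCoeff (N : ℝ) (i : AtomIndex d) : Continuous (boxCoeff N i) :=
  continuous_finsetProd _ fun j _ => (continuous_expCoeff _ _).comp (by fun_prop)

/-- Fubini and the substitution `y ↦ N y` in each coordinate; the factors `N` in `boxWindow` cancel
the Jacobian. -/
lemma boxCoeff_eq_integral {N : ℝ} (hN : 0 < N) (i : AtomIndex d) (ξ : Euc d) :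
    boxCoeff N i ξ = ∫ y : Fin d → ℝ, unitExp (inner ℝ ξ (WithLp.toLp 2 y)) * boxWindow N i y := by
  have h := integral_fintype_prod_volume_eq_prod (𝕜 := ℂ) (E := fun _ : Fin d => ℝ)
    fun j y => unitExp (ξ j * y) * ((N : ℂ) * window (i.1 j) (i.2 j) (N * y))
  simp only [Finset.prod_mul_distrib (f := fun j => unitExp _)] at h
  simp only [inner_euc, unitExp_sum, boxWindow]
  rw [h, boxCoeff]
  refine Finset.prod_congr rfl fun j _ => ?_
  have h1 := Measure.integral_comp_mul_left
    (fun y : ℝ => unitExp (ξ j / N * y) * ((N : ℂ) * window (i.1 j) (i.2 j) y)) N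
  have h2 : ∀ y : ℝ, ξ j / N * (N * y) = ξ j * y := fun y => by field_simp
  simp only [h2] at h1
  rw [h1, abs_of_pos (inv_pos.2 hN), expCoeff]
  have h3 : ∀ y : ℝ, unitExp (ξ j / N * y) * ((N : ℂ) * window (i.1 j) (i.2 j) y) =
      N * (unitExp (ξ j / N * y) * window (i.1 j) (i.2 j) y) := fun y => by ring
  simp only [h3]
  rw [integral_const_mul, Complex.real_smul, ← mul_assoc, ← Complex.ofReal_mul,
    inv_mul_cancel₀ hN.ne', Complex.ofReal_one, one_mul]

lemma boxWindow_eq_zero {N : ℝ} {k l : Fin d → ℤ} {y : Fin d → ℝ}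
    (h : boxCutoff N k (WithLp.toLp 2 y) = 0) : boxWindow N (k, l) y = 0 := by
  obtain ⟨j, hj, h0⟩ := Finset.prod_eq_zero_iff.1 h
  refine Finset.prod_eq_zero hj ?_
  simp only at h0
  simp [window, h0]

/-! ### Fourier transforms of finite measures on `ℝ^d` -/

section
variable {X : Type*} [MeasurableSpace X] (μ : Measure X) (F : X → ℂ) (s : X → Euc d)

/-- The Fourier transform of the pushforward of `F dμ` under `s`. -/
def pushFourier (x : Euc d) : ℂ := ∫ χ, F χ * unitExp (inner ℝ (s χ) x) ∂μ

/-- The coefficients of `pushFourier μ F s`. -/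
def pushCoeff (N : ℝ) (i : AtomIndex d) : ℂ := ∫ χ, F χ * boxCoeff N i (s χ) ∂μ

variable {μ F s}

lemma integrable_mul_bounded {f : X → ℂ} (hF : Integrable F μ) (hf : AEStronglyMeasurable f μ)
    (C : ℝ) (h : ∀ χ, ‖f χ‖ ≤ C) : Integrable (fun χ => F χ * f χ) μ :=
  hF.mul_bdd hf (.of_forall h)

lemma pushCoeff_integrable (hF : Integrable F μ) (hs : Measurable s) (N : ℝ) (i : AtomIndex d) :
    Integrable (fun χ => F χ * boxCoeff N i (s χ)) μ := by
  obtain ⟨A, -, hA⟩ := exists_boxCoeff_bound d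
  exact integrable_mul_bounded hF
    ((continuous_boxCoeff N i).measurable.comp hs).aestronglyMeasurable A fun χ =>
    ((hA N i.1 (s χ)).1.le_tsum i.2 fun _ _ => norm_nonneg _).trans (hA N i.1 (s χ)).2

/-- Integrates the uniform `ℓ¹` bound for exponentials against `‖F‖`. Finite sums suffice, since
bounded partial sums of nonnegative terms give summability. -/
lemma sum_integral_norm_pushCoeff_le {A N : ℝ} (hF : Integrable F μ) (hs : Measurable s)
    {k : Fin d → ℤ} (hA : ∀ ξ : Euc d, Summable (fun l => ‖boxCoeff N (k, l) ξ‖) ∧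
      ∑' l, ‖boxCoeff N (k, l) ξ‖ ≤ A) (S : Finset (Fin d → ℤ)) :
    ∑ l ∈ S, ∫ χ, ‖F χ * boxCoeff N (k, l) (s χ)‖ ∂μ ≤ A * ∫ χ, ‖F χ‖ ∂μ := by
  rw [← integral_finsetSum _ fun l _ => (pushCoeff_integrable hF hs N (k, l)).norm,
    ← integral_const_mul]
  refine integral_mono (integrable_finsetSum _
    fun l _ => (pushCoeff_integrable hF hs N (k, l)).norm) (hF.norm.const_mul _) fun χ => ?_
  simp only [norm_mul]
  rw [← Finset.mul_sum, mul_comm]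
  gcongr
  exact ((hA (s χ)).1.sum_le_tsum S fun _ _ => norm_nonneg _).trans (hA (s χ)).2

lemma summable_integral_norm_pushCoeff (hF : Integrable F μ) (hs : Measurable s) (N : ℝ)
    (k : Fin d → ℤ) : Summable fun l => ∫ χ, ‖F χ * boxCoeff N (k, l) (s χ)‖ ∂μ := by
  obtain ⟨A, -, hA⟩ := exists_boxCoeff_bound d
  exact summable_of_sum_le (fun l => integral_nonneg fun _ => norm_nonneg _)
    (sum_integral_norm_pushCoeff_le hF hs (hA N k))

lemma summable_norm_pushCoeff (hF : Integrable F μ) (hs : Measurable s) (N : ℝ)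
    (k : Fin d → ℤ) : Summable fun l => ‖pushCoeff μ F s N (k, l)‖ :=
  (summable_integral_norm_pushCoeff hF hs N k).of_nonneg_of_le (fun _ => norm_nonneg _)
    fun _ => norm_integral_le_integral_norm _

lemma tsum_norm_pushCoeff_le {A N : ℝ} (hF : Integrable F μ) (hs : Measurable s)
    {k : Fin d → ℤ} (hA : ∀ ξ : Euc d, Summable (fun l => ‖boxCoeff N (k, l) ξ‖) ∧
      ∑' l, ‖boxCoeff N (k, l) ξ‖ ≤ A) :
    ∑' l, ‖pushCoeff μ F s N (k, l)‖ ≤ A * ∫ χ, ‖F χ‖ ∂μ :=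
  (summable_norm_pushCoeff hF hs N k).tsum_le_of_sum_le fun S =>
    (Finset.sum_le_sum fun _ _ => norm_integral_le_integral_norm _).trans
      (sum_integral_norm_pushCoeff_le hF hs hA S)

/-- The expansion of exponentials, integrated against `F dμ`; the `ℓ¹` bound justifies exchanging
sum and integral. -/
lemma hasSum_pushCoeff_mul_boxAtom {N : ℝ} (hN : 0 < N) (hF : Integrable F μ) (hs : Measurable s)
    (k : Fin d → ℤ) (x : Euc d) :
    HasSum (fun l => pushCoeff μ F s N (k, l) * boxAtom N (k, l) x)
      (boxCutoff N k x * pushFourier μ F s x) := by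
  have h := hasSum_integral_of_summable_integral_norm
    (F := fun l χ => F χ * boxCoeff N (k, l) (s χ) * boxAtom N (k, l) x) (μ := μ)
    (fun l => (pushCoeff_integrable hF hs N (k, l)).mul_const _) ?_
  · simp only [integral_mul_const] at h
    suffices hv : boxCutoff N k x * pushFourier μ F s x =
        ∫ χ, ∑' l, F χ * boxCoeff N (k, l) (s χ) * boxAtom N (k, l) x ∂μ by
      rw [hv]
      exact h
    rw [pushFourier, ← integral_const_mul]
    refine integral_congr_ae (.of_forall fun χ => ?_)
    simp only [mul_assoc]
    rw [tsum_mul_left, (hasSum_boxCoeff_mul_boxAtom hN k (s χ) x).tsum_eq]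
    ring
  · refine (summable_integral_norm_pushCoeff hF hs N k).of_nonneg_of_le
      (fun l => integral_nonneg fun _ => norm_nonneg _) fun l => ?_
    refine integral_mono ((pushCoeff_integrable hF hs N (k, l)).mul_const _).norm
      (pushCoeff_integrable hF hs N (k, l)).norm fun χ => ?_
    change ‖F χ * boxCoeff N (k, l) (s χ) * boxAtom N (k, l) x‖ ≤ _
    rw [norm_mul]
    exact mul_le_of_le_one_right (norm_nonneg _) (norm_boxAtom_le _ _ _)

/-- By Fubini the coefficients are integrals of the function itself against the windows. They
therefore do not depend on how the function is represented, which makes them linear functionals on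
`S0 (Euc d)`. -/
lemma integral_pushFourier_mul_boxWindow [SFinite μ] {N : ℝ} (hN : 0 < N) (hF : Integrable F μ)
    (hs : Measurable s) (i : AtomIndex d) :
    ∫ y : Fin d → ℝ, pushFourier μ F s (WithLp.toLp 2 y) * boxWindow N i y =
      pushCoeff μ F s N i := by
  simp only [pushFourier, ← integral_mul_const, pushCoeff]
  rw [integral_integral_swap]
  · refine integral_congr_ae (.of_forall fun χ => ?_)
    simp only [mul_assoc]
    rw [integral_const_mul, boxCoeff_eq_integral hN]
  · have h1 : Integrable (fun p : (Fin d → ℝ) × X => F p.2 * boxWindow N i p.1)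
        ((volume : Measure (Fin d → ℝ)).prod μ) := by
      simpa only [mul_comm] using (integrable_boxWindow hN i).mul_prod hF
    have h2 := integrable_mul_bounded
      (f := fun p : (Fin d → ℝ) × X => unitExp (inner ℝ (s p.2) (WithLp.toLp 2 p.1))) h1 ?_ 1
      (fun _ => by simp)
    · refine h2.congr (.of_forall fun p => ?_)
      simp only [Function.uncurry]
      ring
    · refine (measurable_unitExp.comp (Measurable.inner (hs.comp measurable_snd) ?_)).aestronglyMeasurable
      exact (PiLp.continuous_toLp 2 _).measurable.comp measurable_fst

lemma continuous_pushFourier (hF : Integrable F μ) (hs : Measurable s) :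
    Continuous (pushFourier μ F s) := by
  refine continuous_of_dominated (bound := fun χ => ‖F χ‖) (fun x => ?_)
    (fun x => .of_forall fun χ => by simp) hF.norm (.of_forall fun χ => by fun_prop)
  exact hF.aestronglyMeasurable.mul
    (measurable_unitExp.comp (hs.inner measurable_const)).aestronglyMeasurable

end
end
end

noncomputable section

/-! ### Groups isometrically embedded in `ℝ^d` whose characters extend measurably -/

open scoped FourierTransform ENNReal

/-- An isometric embedding of `G` in `ℝ^d`, with a measurable choice of a frequency for every
character of `G`. -/
structure FreqEmbedding (G : Type) [NormedAddCommGroup G] (d : ℕ) where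
  /-- The embedding. -/
  emb : G →+ Euc d
  norm_emb : ∀ x, ‖emb x‖ = ‖x‖
  /-- The frequency of a character. -/
  freq : CharGroup G → Euc d
  measurable_freq : Measurable freq
  charEval_eq : ∀ χ x, charEval χ x = unitExp (inner ℝ (freq χ) (emb x))

/-- The dual carries the topology induced from continuous maps into the circle, and this is second
countable because `G` is second countable and locally compact. -/
instance instSecondCountableTopologyCharGroup (G : Type) [NormedAddCommGroup G] [ProperSpace G] :
    SecondCountableTopology (CharGroup G) := by
  have : SecondCountableTopology (Multiplicative G) := inferInstanceAs (SecondCountableTopology G)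
  have : LocallyCompactSpace (Multiplicative G) := inferInstanceAs (LocallyCompactSpace G)
  exact (ContinuousMonoidHom.isInducing_toContinuousMap
    (Multiplicative G) Circle).secondCountableTopology

lemma continuous_charEval {G : Type} [NormedAddCommGroup G] (χ : CharGroup G) :
    Continuous (charEval χ) :=
  continuous_subtype_val.comp ((map_continuous χ).comp continuous_ofAdd)

lemma continuous_charEval_left {G : Type} [NormedAddCommGroup G] (x : G) :
    Continuous fun χ : CharGroup G => charEval χ x :=
  continuous_subtype_val.comp
    (ContinuousEvalConst.continuous_eval_const (F := Multiplicative G →ₜ* Circle)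
      (Multiplicative.ofAdd x))

lemma charEval_add {G : Type} [NormedAddCommGroup G] (χ : CharGroup G) (x y : G) :
    charEval χ (x + y) = charEval χ x * charEval χ y := by
  simp [charEval]

lemma charEval_ext {G : Type} [NormedAddCommGroup G] {χ η : CharGroup G}
    (h : ∀ x, charEval χ x = charEval η x) : χ = η :=
  PontryaginDual.ext fun a => Subtype.ext (h a.toAdd)

namespace FreqEmbedding
variable {G : Type} [NormedAddCommGroup G] {d : ℕ} (e : FreqEmbedding G d)

lemma continuous_emb : Continuous e.emb := by
  refine (AddMonoidHomClass.isometry_of_norm e.emb e.norm_emb).continuous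

/-- The character with a given frequency. -/
def char (ξ : Euc d) : CharGroup G :=
  ({ toFun := fun x => 𝐞 (inner ℝ ξ (e.emb x.toAdd))
     map_one' := by simp
     map_mul' := fun x y => by simp [inner_add_right, AddChar.map_add_eq_mul]
     continuous_toFun := by
       have := e.continuous_emb
       exact Real.continuous_fourierChar.comp
         (continuous_const.inner (this.comp continuous_toAdd)) } : Multiplicative G →ₜ* Circle)

lemma charEval_char (ξ : Euc d) (x : G) : charEval (e.char ξ) x = unitExp (inner ℝ ξ (e.emb x)) :=
  rfl

lemma char_freq (χ : CharGroup G) : e.char (e.freq χ) = χ :=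
  charEval_ext fun x => by rw [charEval_char, e.charEval_eq]

lemma char_add (ξ η : Euc d) : e.char (ξ + η) = e.char ξ * e.char η :=
  charEval_ext fun x => by
    rw [charEval_char, inner_add_left, unitExp_add]; rfl

lemma continuous_char : Continuous e.char := by
  refine ContinuousMonoidHom.continuous_of_continuous_uncurry
    (A := Euc d) (B := Multiplicative G) (C := Circle) e.char ?_
  have := e.continuous_emb
  exact Real.continuous_fourierChar.comp
    (continuous_fst.inner (this.comp (continuous_toAdd.comp continuous_snd)))

variable [ProperSpace G]

-- The dual is σ-compact, being the image of `ℝ^d` under the continuous surjection `e.char`.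
include e in
lemma sigmaFinite_haar : SigmaFinite (Measure.haar : Measure (CharGroup G)) := by
  have : SigmaCompactSpace (CharGroup G) := by
    refine isSigmaCompact_univ_iff.1 ?_
    rw [← Set.range_eq_univ.2 (Function.RightInverse.surjective e.char_freq)]
    exact isSigmaCompact_range e.continuous_char
  infer_instance

/-- Since `e.char` is a surjective homomorphism, the image of Lebesgue measure is translation
invariant. It may fail to be σ-finite (for `G = ℤ`, say), but only its null sets are needed. -/
lemma map_char_absolutelyContinuous :
    (volume : Measure (Euc d)).map e.char ≪ (Measure.haar : Measure (CharGroup G)) := by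
  have := e.sigmaFinite_haar
  have hm := e.continuous_char.measurable
  have : ((volume : Measure (Euc d)).map e.char).IsMulLeftInvariant := by
    refine ⟨fun χ => ?_⟩
    have h2 : (fun η => χ * η) ∘ e.char = e.char ∘ fun ξ => e.freq χ + ξ := by
      funext ξ
      simp [char_add, char_freq]
    rw [Measure.map_map (measurable_const_mul χ) hm, h2,
      ← Measure.map_map hm (measurable_const_add _), map_add_left_eq_self]
  refine absolutelyContinuous_of_isMulLeftInvariant _ _ (NeZero.ne _)

/-- `K` is the Haar density of the image of `F dξ` under `e.char`, in effect the periodization of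
`F` along the frequencies that are trivial on `G`. Positivity makes its norm the total mass. -/
lemma exists_dualFourier_ofReal {F : Euc d → ℝ} (hF : Integrable F) (h0 : ∀ ξ, 0 ≤ F ξ) :
    ∃ K : CharGroup G → ℂ, Integrable K (Measure.haar : Measure (CharGroup G)) ∧
      (∀ x, dualFourier K x = ∫ ξ, (F ξ : ℂ) * unitExp (inner ℝ ξ (e.emb x))) ∧
      dualNorm K = ∫ ξ, F ξ := by
  have := e.sigmaFinite_haar
  have hm := e.continuous_char.measurable
  let m : Measure (Euc d) := volume.withDensity fun ξ => ENNReal.ofReal (F ξ)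
  have : IsFiniteMeasure m := isFiniteMeasure_withDensity_ofReal hF.2
  let ν : Measure (CharGroup G) := m.map e.char
  have hν : ν ≪ Measure.haar :=
    ((withDensity_absolutelyContinuous _ _).map hm).trans e.map_char_absolutelyContinuous
  have hint : ∀ f : CharGroup G → ℂ, Measurable f →
      ∫ χ, f χ ∂ν = ∫ ξ, (F ξ : ℂ) * f (e.char ξ) := fun f hf => by
    rw [integral_map hm.aemeasurable hf.aestronglyMeasurable,
      integral_withDensity_eq_integral_toReal_smul₀ hF.aemeasurable.ennreal_ofReal (by simp)]
    refine integral_congr_ae (.of_forall fun ξ => ?_)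
    simp [ENNReal.toReal_ofReal (h0 ξ)]
  have hK : Integrable (fun χ => (((ν.rnDeriv Measure.haar χ).toReal : ℝ) : ℂ))
      (Measure.haar : Measure (CharGroup G)) := Measure.integrable_toReal_rnDeriv.ofReal
  refine ⟨_, hK, fun x => ?_, ?_⟩
  · have h := integral_rnDeriv_smul hν (f := fun χ => charEval χ x)
    simp only [Complex.real_smul] at h
    rw [dualFourier, h, hint _ (continuous_charEval_left x).measurable]
    simp [charEval_char]
  · have h1 : ∫ χ, (ν.rnDeriv Measure.haar χ).toReal ∂Measure.haar = ∫ χ, (1 : ℝ) ∂ν := by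
      rw [← integral_rnDeriv_smul hν (f := fun _ => (1 : ℝ))]
      simp
    have h2 := hint (fun _ => 1) measurable_const
    simp only [mul_one, integral_const, smul_eq_mul, Complex.real_smul] at h1 h2
    simp only [dualNorm, Complex.norm_real, Real.norm_of_nonneg ENNReal.toReal_nonneg]
    rw [h1]
    rw [integral_complex_ofReal] at h2
    exact_mod_cast h2

/-- The restriction of the Fourier transform of an integrable function on `ℝ^d` to `G` belongs to
the Fourier algebra of `G`. -/
lemma exists_dualFourier {F : Euc d → ℂ} (hF : Integrable F) :
    ∃ K : CharGroup G → ℂ, Integrable K (Measure.haar : Measure (CharGroup G)) ∧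
      (∀ x, dualFourier K x = ∫ ξ, F ξ * unitExp (inner ℝ ξ (e.emb x))) ∧
      dualNorm K ≤ 4 * ∫ ξ, ‖F ξ‖ := by
  -- The positive and negative parts each cost at most `∫ ‖F‖`; applying this to the real and
  -- imaginary parts gives the factor `4`.
  have key : ∀ f : Euc d → ℝ, Integrable f → (∀ ξ, |f ξ| ≤ ‖F ξ‖) →
      ∃ K : CharGroup G → ℂ, Integrable K (Measure.haar : Measure (CharGroup G)) ∧
      (∀ x, dualFourier K x = ∫ ξ, (f ξ : ℂ) * unitExp (inner ℝ ξ (e.emb x))) ∧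
      dualNorm K ≤ 2 * ∫ ξ, ‖F ξ‖ := by
    intro f hf hle
    obtain ⟨K, hK, hK1, hK2⟩ := e.exists_dualFourier_ofReal hf.pos_part fun _ => le_max_right _ _
    obtain ⟨L, hL, hL1, hL2⟩ := e.exists_dualFourier_ofReal hf.neg_part fun _ => le_max_right _ _
    have hmul : ∀ (k : Euc d → ℝ) (x : G), Integrable k →
        Integrable fun ξ => (k ξ : ℂ) * unitExp (inner ℝ ξ (e.emb x)) := fun k x hk =>
      integrable_mul_bounded hk.ofReal
        (by fun_prop : Continuous fun ξ : Euc d => unitExp (inner ℝ ξ (e.emb x))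
          ).aestronglyMeasurable 1 (fun _ => by simp)
    have hmulK : ∀ (k : CharGroup G → ℂ) (x : G), Integrable k Measure.haar →
        Integrable (fun χ => k χ * charEval χ x) Measure.haar := fun k x hk =>
      integrable_mul_bounded hk (continuous_charEval_left x).measurable.aestronglyMeasurable
        1 (fun _ => (norm_charEval _ _).le)
    refine ⟨fun χ => K χ - L χ, hK.sub hL, fun x => ?_, ?_⟩
    · have h1 : dualFourier (fun χ => K χ - L χ) x = dualFourier K x - dualFourier L x := by
        simp only [dualFourier, sub_mul]
        exact integral_sub (hmulK _ _ hK) (hmulK _ _ hL)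
      rw [h1, hK1, hL1, ← integral_sub (hmul _ _ hf.pos_part) (hmul _ _ hf.neg_part)]
      refine integral_congr_ae (.of_forall fun ξ => ?_)
      simp only [← sub_mul]
      congr 1
      norm_cast
      rcases le_total 0 (f ξ) with h | h
      · simp [h]
      · simp [h]
    · have h1 : dualNorm (fun χ => K χ - L χ) ≤ dualNorm K + dualNorm L := by
        simp only [dualNorm]
        rw [← integral_add hK.norm hL.norm]
        exact integral_mono (hK.sub hL).norm (hK.norm.add hL.norm) fun χ => norm_sub_le _ _
      have h2 : dualNorm K ≤ ∫ ξ, ‖F ξ‖ := hK2 ▸ integral_mono hf.pos_part hF.norm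
        fun ξ => max_le ((le_abs_self _).trans (hle ξ)) (norm_nonneg _)
      have h3 : dualNorm L ≤ ∫ ξ, ‖F ξ‖ := hL2 ▸ integral_mono hf.neg_part hF.norm
        fun ξ => max_le ((neg_le_abs _).trans (hle ξ)) (norm_nonneg _)
      linarith
  obtain ⟨K, hK, hK1, hK2⟩ := key _ hF.re fun ξ => Complex.abs_re_le_norm _
  obtain ⟨L, hL, hL1, hL2⟩ := key _ hF.im fun ξ => Complex.abs_im_le_norm _
  have hmul : ∀ (k : Euc d → ℝ) (x : G), Integrable k →
      Integrable fun ξ => (k ξ : ℂ) * unitExp (inner ℝ ξ (e.emb x)) := fun k x hk =>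
    integrable_mul_bounded hk.ofReal
      (by fun_prop : Continuous fun ξ : Euc d => unitExp (inner ℝ ξ (e.emb x))
        ).aestronglyMeasurable 1 (fun _ => by simp)
  have hmulK : ∀ (k : CharGroup G → ℂ) (x : G), Integrable k Measure.haar →
      Integrable (fun χ => k χ * charEval χ x) Measure.haar := fun k x hk =>
    integrable_mul_bounded hk (continuous_charEval_left x).measurable.aestronglyMeasurable
      1 (fun _ => (norm_charEval _ _).le)
  have hLI : Integrable (fun χ => Complex.I * L χ) Measure.haar := hL.const_mul _
  refine ⟨fun χ => K χ + Complex.I * L χ, hK.add hLI, fun x => ?_, ?_⟩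
  · have h1 : dualFourier (fun χ => K χ + Complex.I * L χ) x =
        dualFourier K x + dualFourier (fun χ => Complex.I * L χ) x := by
      simp only [dualFourier, add_mul]
      exact integral_add (hmulK _ _ hK) (hmulK _ _ hLI)
    rw [h1, dualFourier_smul, hK1, hL1, ← integral_const_mul,
      ← integral_add (hmul _ _ hF.re) ((hmul _ _ hF.im).const_mul _)]
    refine integral_congr_ae (.of_forall fun ξ => ?_)
    simp only [← mul_assoc, ← add_mul]
    congr 1
    rw [mul_comm Complex.I]
    exact Complex.re_add_im _
  · have h1 : dualNorm (fun χ => K χ + Complex.I * L χ) ≤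
        dualNorm K + dualNorm (fun χ => Complex.I * L χ) := by
      simp only [dualNorm]
      rw [← integral_add hK.norm hLI.norm]
      exact integral_mono (hK.add hLI).norm (hK.norm.add hLI.norm) fun χ => norm_add_le _ _
    rw [dualNorm_smul, Complex.norm_I, one_mul] at h1
    linarith

lemma dualFourier_eq_pushFourier (F : CharGroup G → ℂ) (x : G) :
    dualFourier F x = pushFourier Measure.haar F e.freq (e.emb x) := by
  simp [dualFourier, pushFourier, e.charEval_eq]

end FreqEmbedding
end

noncomputable section

/-! ### Characters of the real line -/

open Filter Topology

/-- Integrating the functional equation over an interval shows that `f` is differentiable with `f' =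
c f`. So `f` is an exponential, and `‖f‖ = 1` forces `c` to be imaginary. -/
lemma exists_unitExp_eq_of_map_add {f : ℝ → ℂ} (hc : Continuous f) (h1 : ∀ t, ‖f t‖ = 1)
    (ha : ∀ s t, f (s + t) = f s * f t) : ∃ θ : ℝ, ∀ t, f t = unitExp (t * θ) := by
  have hne : ∀ t, f t ≠ 0 := fun t h => by simpa [h] using h1 t
  have h0 : f 0 = 1 := by
    have := ha 0 0
    rw [add_zero] at this
    exact (mul_eq_left₀ (hne 0)).1 this.symm
  have hI : ∀ t, HasDerivAt (fun t => ∫ s in (0 : ℝ)..t, f s) (f t) t := fun t =>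
    intervalIntegral.integral_hasDerivAt_right (hc.intervalIntegrable _ _)
      (hc.stronglyMeasurableAtFilter _ _) hc.continuousAt
  -- The integral from `0` has derivative `f 0 ≠ 0` at `0`, so it is nonzero for some `δ`.
  obtain ⟨δ, hδ⟩ := ((hI 0).eventually_ne (c := 0) (hne 0)).exists
  set I := ∫ s in (0 : ℝ)..δ, f s with hIdef
  have hf : ∀ t, f t = ((∫ s in (0 : ℝ)..(t + δ), f s) - ∫ s in (0 : ℝ)..t, f s) / I := fun t => by
    rw [eq_div_iff hδ, intervalIntegral.integral_interval_sub_left (hc.intervalIntegrable _ _)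
      (hc.intervalIntegrable _ _), hIdef, ← intervalIntegral.integral_const_mul]
    simp only [← ha]
    rw [intervalIntegral.integral_comp_add_left (f := f), add_zero]
  have hd : ∀ t, HasDerivAt f (((f δ - 1) / I) * f t) t := fun t => by
    have h2 := ((hI (t + δ)).comp_add_const t δ).sub (hI t)
    have h3 : HasDerivAt (fun t => ((∫ s in (0 : ℝ)..(t + δ), f s) - ∫ s in (0 : ℝ)..t, f s) / I)
        ((f (t + δ) - f t) / I) t := h2.div_const I
    have h4 : f = fun t => ((∫ s in (0 : ℝ)..(t + δ), f s) - ∫ s in (0 : ℝ)..t, f s) / I :=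
      funext hf
    rw [← h4] at h3
    convert h3 using 1
    rw [ha]
    ring
  set c := (f δ - 1) / I
  have hexp : ∀ t : ℝ, f t = Complex.exp (c * t) := fun t => by
    have hd2 : ∀ t : ℝ, HasDerivAt (fun t : ℝ => f t * Complex.exp (-(c * t))) 0 t := fun t => by
      have h2 : HasDerivAt (fun t : ℝ => Complex.exp (-(c * t)))
          (Complex.exp (-(c * t)) * -(c * 1)) t :=
        (((Complex.ofRealCLM.hasDerivAt (x := t)).const_mul c).neg).cexp
      have h3 : c * f t * Complex.exp (-(c * t)) +
          f t * (Complex.exp (-(c * t)) * -(c * 1)) = 0 := by ring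
      exact h3 ▸ (hd t).mul h2
    have h3 := is_const_of_deriv_eq_zero (fun t => (hd2 t).differentiableAt)
      (fun t => (hd2 t).deriv) t 0
    simp only [h0, Complex.ofReal_zero, mul_zero, neg_zero, Complex.exp_zero, mul_one] at h3
    rw [Complex.exp_neg, mul_inv_eq_one₀ (Complex.exp_ne_zero _)] at h3
    exact h3
  have hre : c.re = 0 := by
    have := h1 1
    rw [hexp, Complex.norm_exp] at this
    simpa using this
  refine ⟨c.im / (2 * Real.pi), fun t => ?_⟩
  rw [hexp, unitExp_eq]
  congr 1
  have hc' : c = c.im * Complex.I := by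
    apply Complex.ext <;> simp [hre]
  rw [hc']
  have : (2 * Real.pi * (t * (c.im / (2 * Real.pi))) : ℝ) = c.im * t := by field_simp
  simp only [Complex.mul_im, Complex.ofReal_im, Complex.I_re, Complex.I_im, Complex.ofReal_re]
  simp only [mul_one, mul_zero, add_zero]
  rw [this]
  push_cast
  ring

lemma arg_unitExp {t : ℝ} (h1 : -(1 / 2) < t) (h2 : t ≤ 1 / 2) :
    (unitExp t).arg = 2 * Real.pi * t := by
  have hpi := Real.pi_pos
  exact Circle.arg_exp (x := 2 * Real.pi * t) (by nlinarith) (by nlinarith)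

/-- Recovers the frequency of a character of the line as a limit of measurable functions of its
values. Once `n > 2|θ|` the argument has no ambiguity and the sequence is constant. -/
lemma tendsto_arg_unitExp (θ : ℝ) :
    Tendsto (fun n : ℕ => n * (unitExp (1 / n * θ)).arg / (2 * Real.pi)) atTop (𝓝 θ) := by
  refine tendsto_const_nhds.congr' ?_
  filter_upwards [eventually_gt_atTop 0, eventually_gt_atTop ⌈2 * |θ|⌉₊] with n hn0 hn
  have hn' : 2 * |θ| < n := Nat.lt_of_ceil_lt hn
  have hn0' : (0 : ℝ) < n := by exact_mod_cast hn0
  have h : |1 / n * θ| < 1 / 2 := by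
    rw [abs_mul, abs_of_pos (by positivity), one_div, inv_mul_lt_iff₀ hn0']
    linarith
  obtain ⟨h1, h2⟩ := abs_lt.1 h
  rw [arg_unitExp h1 h2.le]
  have := Real.pi_pos
  field_simp

lemma exists_unitExp_eq_of_norm_eq_one {z : ℂ} (h : ‖z‖ = 1) :
    z = unitExp (z.arg / (2 * Real.pi)) := by
  rw [unitExp_eq]
  conv_lhs => rw [← Complex.norm_mul_exp_arg_mul_I z, h]
  have := Real.pi_pos
  rw [mul_div_cancel₀ _ (by positivity)]
  simp

/-! ### Measurable extension of characters -/

/-- The coordinate functionals on the span, extended to `E` and represented by vectors. -/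
lemma LinearIndependent.exists_dual {E ι : Type*} [NormedAddCommGroup E] [InnerProductSpace ℝ E]
    [FiniteDimensional ℝ E] [DecidableEq ι] {u : ι → E} (hu : LinearIndependent ℝ u) :
    ∃ w : ι → E, ∀ i j, inner ℝ (w i) (u j) = if i = j then 1 else 0 := by
  choose f hf using fun i => LinearMap.exists_extend ((Module.Basis.span hu).coord i)
  refine ⟨fun i => (InnerProductSpace.toDual ℝ E).symm (LinearMap.toContinuousLinearMap (f i)),
    fun i j => ?_⟩
  rw [InnerProductSpace.toDual_symm_apply]
  have h1 := LinearMap.congr_fun (hf i) (Module.Basis.span hu j)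
  rw [LinearMap.comp_apply, Module.Basis.coord_apply, Module.Basis.repr_self,
    Submodule.subtype_apply, Module.Basis.span_apply, Finsupp.single_apply] at h1
  simp only [LinearMap.coe_toContinuousLinearMap', h1, eq_comm]

lemma charEval_sum {G ι : Type} [NormedAddCommGroup G] (χ : CharGroup G) (s : Finset ι)
    (f : ι → G) : charEval χ (∑ i ∈ s, f i) = ∏ i ∈ s, charEval χ (f i) := by
  classical
  induction s using Finset.induction_on with
  | empty => simp [charEval]
  | insert a s ha ih => rw [Finset.sum_insert ha, Finset.prod_insert ha, charEval_add, ih]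

lemma charEval_zsmul {G : Type} [NormedAddCommGroup G] (χ : CharGroup G) (n : ℤ) (x : G) :
    charEval χ (n • x) = charEval χ x ^ n := by
  simp [charEval]

lemma unitExp_mul_int (t : ℝ) (n : ℤ) : unitExp (n * t) = unitExp t ^ n := by
  rw [unitExp, unitExp, ← zsmul_eq_mul, AddChar.map_zsmul_eq_zpow, Circle.coe_zpow]

/-- If `G` is generated by finitely many lines and finitely many points whose images in `ℝ^d` are
linearly independent, then the characters of `G` extend measurably to `ℝ^d`. -/
theorem exists_freqEmbedding {G : Type} [NormedAddCommGroup G] {d : ℕ} (emb : G →+ Euc d)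
    (hemb : ∀ x, ‖emb x‖ = ‖x‖) {α β : Type} [Fintype α] [Fintype β] (v : α → Euc d)
    (p : α → ℝ → G) (hp : ∀ a t, emb (p a t) = t • v a) (q : β → G)
    (hli : LinearIndependent ℝ (Sum.elim v (emb ∘ q)))
    (hgen : ∀ x : G, ∃ (t : α → ℝ) (n : β → ℤ), x = ∑ a, p a (t a) + ∑ b, n b • q b) :
    ∃ e : FreqEmbedding G d, e.emb = emb := by
  classical
  have hiso : Isometry emb := AddMonoidHomClass.isometry_of_norm emb hemb
  have hpadd : ∀ a s t, p a (s + t) = p a s + p a t := fun a s t =>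
    hiso.injective (by rw [map_add, hp, hp, hp, add_smul])
  have hpc : ∀ a, Continuous (p a) := fun a => by
    refine hiso.isEmbedding.continuous_iff.2 ?_
    have : emb ∘ p a = fun t : ℝ => t • v a := funext fun t => hp a t
    rw [this]
    fun_prop
  have hθ : ∀ (χ : CharGroup G) (a : α), ∃ θ : ℝ, ∀ t, charEval χ (p a t) = unitExp (t * θ) :=
    fun χ a => exists_unitExp_eq_of_map_add ((continuous_charEval χ).comp (hpc a))
      (fun t => norm_charEval _ _) fun s t => by
        rw [hpadd, charEval_add]
  choose θ hθ using hθ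
  have hθm : ∀ a, Measurable fun χ => θ χ a := fun a => by
    refine measurable_of_tendsto_metrizable (f := fun (n : ℕ) χ =>
      n * (charEval χ (p a (1 / n))).arg / (2 * Real.pi)) (fun n => ?_) ?_
    · exact ((Complex.measurable_arg.comp (continuous_charEval_left _).measurable).const_mul
        _).div_const _
    · refine tendsto_pi_nhds.2 fun χ => ?_
      simp only [hθ]
      exact tendsto_arg_unitExp _
  obtain ⟨w, hw⟩ := hli.exists_dual
  -- On a discrete generator the frequency matters only modulo one, so the principal argument is an
  -- admissible measurable choice.
  let τ : CharGroup G → β → ℝ := fun χ b => (charEval χ (q b)).arg / (2 * Real.pi)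
  have hτm : ∀ b, Measurable fun χ => τ χ b := fun b =>
    (Complex.measurable_arg.comp (continuous_charEval_left _).measurable).div_const _
  refine ⟨⟨emb, hemb, fun χ => ∑ a, θ χ a • w (.inl a) + ∑ b, τ χ b • w (.inr b), ?_,
    fun χ x => ?_⟩, rfl⟩
  · refine (Finset.measurable_sum _ fun a _ => (hθm a).smul_const _).add
      (Finset.measurable_sum _ fun b _ => (hτm b).smul_const _)
  · have hwv : ∀ i a, inner ℝ (w i) (v a) = if i = .inl a then 1 else 0 := fun i a => hw i (.inl a)
    have hwq : ∀ i b, inner ℝ (w i) (emb (q b)) = if i = .inr b then 1 else 0 :=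
      fun i b => hw i (.inr b)
    obtain ⟨t, n, rfl⟩ := hgen x
    have hin : inner ℝ (∑ a, θ χ a • w (.inl a) + ∑ b, τ χ b • w (.inr b))
        (emb (∑ a, p a (t a) + ∑ b, n b • q b)) =
        ∑ a, t a * θ χ a + ∑ b, n b * τ χ b := by
      simp only [map_add, map_sum, map_zsmul, hp, inner_add_left, inner_add_right, sum_inner,
        inner_sum, real_inner_smul_left, real_inner_smul_right, hwv, hwq,
        ← Int.cast_smul_eq_zsmul ℝ]
      simp [mul_comm]
    rw [hin, unitExp_add, unitExp_sum, unitExp_sum, charEval_add, charEval_sum, charEval_sum]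
    congr 1
    · exact Finset.prod_congr rfl fun a _ => hθ _ _ _
    · refine Finset.prod_congr rfl fun b _ => ?_
      rw [charEval_zsmul, unitExp_mul_int, ← exists_unitExp_eq_of_norm_eq_one (norm_charEval _ _)]

theorem exists_freqEmbedding_euc (d : ℕ) :
    ∃ e : FreqEmbedding (Euc d) d, ∀ x, e.emb x = x := by
  let b := EuclideanSpace.basisFun (Fin d) ℝ
  obtain ⟨e, he⟩ := exists_freqEmbedding (AddMonoidHom.id (Euc d)) (fun _ => rfl)
    (α := Fin d) (β := Empty) b (fun a t => t • b a) (fun _ _ => rfl) Empty.elim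
    (LinearIndependent.sum_type b.orthonormal.linearIndependent (linearIndependent_empty_type)
      (by simp [Set.range_eq_empty])) fun x => ⟨fun a => b.repr x a, fun _ => 0, by simp [b.sum_repr]⟩
  exact ⟨e, fun x => by rw [he]; rfl⟩

/-! ### Closed subgroups of `ℝ^d` -/

section
variable {E : Type*} [NormedAddCommGroup E] [InnerProductSpace ℝ E]

/-- The largest linear subspace contained in an additive subgroup. -/
def AddSubgroup.lineSpace (H : AddSubgroup E) : Submodule ℝ E where
  carrier := {v | ∀ t : ℝ, t • v ∈ H}
  add_mem' hx hy t := by rw [smul_add]; exact H.add_mem (hx t) (hy t)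
  zero_mem' t := by rw [smul_zero]; exact H.zero_mem
  smul_mem' c x hx t := by rw [smul_smul]; exact hx _

lemma AddSubgroup.lineSpace_le {H : AddSubgroup E} {v : E} (h : v ∈ H.lineSpace) : v ∈ H := by
  simpa using h 1

/-- Otherwise take nonzero elements of `H` orthogonal to `H.lineSpace` that tend to zero. A limit
`u` of their directions spans a line contained in `H`, so the unit vector `u` lies in `H.lineSpace`
and is orthogonal to it. -/
lemma AddSubgroup.exists_isolated_zero [FiniteDimensional ℝ E] (H : AddSubgroup E) (hH : IsClosed (H : Set E)) :
    ∃ ε > 0, ∀ x ∈ H, x ∈ H.lineSpaceᗮ → ‖x‖ < ε → x = 0 := by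
  by_contra! hcon
  choose x hxH hxW hxn hx0 using fun n : ℕ => hcon (1 / (n + 1)) (by positivity)
  have hpos : ∀ n, 0 < ‖x n‖ := fun n => norm_pos_iff.2 (hx0 n)
  have hxlim : Tendsto (fun n => ‖x n‖) atTop (𝓝 0) :=
    squeeze_zero (fun _ => norm_nonneg _) (fun n => (hxn n).le) tendsto_one_div_add_atTop_nhds_zero_nat
  obtain ⟨u, hu, σ, hσ, hlim⟩ := (isCompact_sphere (0 : E) 1).tendsto_subseq
    (x := fun n => ‖x n‖⁻¹ • x n) fun n => by
      simp [norm_smul, inv_mul_cancel₀ (hpos n).ne']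
  have hσlim := hxlim.comp hσ.tendsto_atTop
  have huW : u ∈ H.lineSpaceᗮ :=
    (Submodule.isClosed_orthogonal _).mem_of_tendsto hlim
      (.of_forall fun n => Submodule.smul_mem _ _ (hxW _))
  -- Integer multiples of the short vectors approximate `t • u` with an error at most their length,
  -- and `H` is closed.
  have huV : u ∈ H.lineSpace := fun t => by
    have h1 : Tendsto (fun n => ⌊t / ‖x (σ n)‖⌋ • x (σ n)) atTop (𝓝 (t • u)) := by
      have h2 : Tendsto (fun n => ⌊t / ‖x (σ n)‖⌋ • x (σ n) - t • (‖x (σ n)‖⁻¹ • x (σ n)))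
          atTop (𝓝 0) := by
        refine squeeze_zero_norm (fun n => ?_) hσlim
        rw [← Int.cast_smul_eq_zsmul ℝ, smul_smul, ← sub_smul, norm_smul, ← div_eq_mul_inv,
          Real.norm_eq_abs, abs_sub_comm, Int.self_sub_floor, abs_of_nonneg (Int.fract_nonneg _)]
        exact mul_le_of_le_one_left (norm_nonneg _) (Int.fract_lt_one _).le
      simpa using h2.add (hlim.const_smul t)
    exact hH.mem_of_tendsto h1 (.of_forall fun n => H.zsmul_mem (hxH _) _)
  have hu0 : u = 0 := by
    have := Submodule.inner_right_of_mem_orthogonal huV huW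
    exact inner_self_eq_zero.1 this
  simp [hu0] at hu

end

theorem exists_freqEmbedding_closed {d : ℕ} (H : AddSubgroup (Euc d))
    (hH : IsClosed (H : Set (Euc d))) :
    ∃ e : FreqEmbedding H d, ∀ x, e.emb x = x := by
  classical
  let V := H.lineSpace
  let L : Submodule ℤ (Euc d) := AddSubgroup.toIntSubmodule (H ⊓ Vᗮ.toAddSubgroup)
  have hL : ∀ x : Euc d, x ∈ L ↔ x ∈ H ∧ x ∈ Vᗮ := fun x => Iff.rfl
  have hdisc : DiscreteTopology L := by
    obtain ⟨ε, hε, h⟩ := H.exists_isolated_zero hH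
    refine discreteTopology_of_isOpen_singleton_zero ?_
    refine Metric.isOpen_singleton_iff.2 ⟨ε, hε, fun y hy => Subtype.ext ?_⟩
    exact h y ((hL _).1 y.2).1 ((hL _).1 y.2).2 (by simpa [dist_eq_norm] using hy)
  let b := Module.Free.chooseBasis ℤ L
  let v := stdOrthonormalBasis ℝ V
  have hspan : Submodule.span ℤ (Set.range fun i => (b i : Euc d)) = L := by
    have : (Set.range fun i => (b i : Euc d)) = L.subtype '' Set.range b := by
      rw [← Set.range_comp]; rfl
    rw [this, ← Submodule.map_span, b.span_eq, Submodule.map_top, Submodule.range_subtype]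
  -- For a discrete subgroup the `ℤ`-rank equals the dimension of the real span, so a `ℤ`-basis is
  -- independent over `ℝ`.
  have hbli : LinearIndependent ℝ fun i => (b i : Euc d) := by
    rw [linearIndependent_iff_card_eq_finrank_span,
      Real.finrank_eq_int_finrank_of_discrete (by rw [hspan]; exact hdisc), Set.finrank, hspan,
      Module.finrank_eq_card_chooseBasisIndex]
  have hvli : LinearIndependent ℝ fun i => (v i : Euc d) :=
    v.orthonormal.linearIndependent.map' V.subtype (Submodule.ker_subtype _)
  have hdisj : Disjoint (Submodule.span ℝ (Set.range fun i => (v i : Euc d)))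
      (Submodule.span ℝ (Set.range fun i => (b i : Euc d))) := by
    refine (Submodule.orthogonal_disjoint V).mono ?_ ?_
    · rw [Submodule.span_le]
      rintro _ ⟨i, rfl⟩
      exact (v i).2
    · rw [Submodule.span_le]
      rintro _ ⟨i, rfl⟩
      exact ((hL _).1 (b i).2).2
  obtain ⟨e, he⟩ := exists_freqEmbedding H.subtype (fun _ => rfl)
    (fun i => (v i : Euc d)) (fun i t => ⟨t • (v i : Euc d), (v i).2 t⟩) (fun _ _ => rfl)
    (fun i => (⟨b i, ((hL _).1 (b i).2).1⟩ : H)) (hvli.sum_type hbli hdisj) fun x => by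
      -- The projection lies in `V ⊆ H`, so the remainder is in `H ∩ Vᗮ = L`: the group is `V ⊕ L`.
      let y : V := V.orthogonalProjectionOnto x
      have hyH : (y : Euc d) ∈ H := AddSubgroup.lineSpace_le y.2
      let z : L := ⟨x - y, (hL _).2 ⟨H.sub_mem x.2 hyH, Submodule.sub_starProjection_mem_orthogonal _⟩⟩
      refine ⟨fun i => v.repr y i, fun i => b.repr z i, Subtype.ext ?_⟩
      have h1 : ∑ i, v.repr y i • (v i : Euc d) = y := by
        have := congrArg (Subtype.val) (v.sum_repr y)
        simpa using this
      have h2 : ∑ i, b.repr z i • (b i : Euc d) = z := by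
        have := congrArg L.subtype (b.sum_repr z)
        rw [map_sum] at this
        exact this
      simp only [AddSubgroup.coe_add, AddSubgroup.val_finsetSum, AddSubgroup.coe_zsmul, h1, h2]
      simp [z]
  exact ⟨e, fun x => by rw [he]; rfl⟩
end

noncomputable section

/-! ### Atoms in `S₀(G)` -/

open scoped FourierTransform SchwartzMap ContDiff

lemma S0.exists_eq_dualFourier {G : Type} [NormedAddCommGroup G] [ProperSpace G]
    {K : CharGroup G → ℂ} (hK : Integrable K (Measure.haar : Measure (CharGroup G)))
    (hs : Function.support (dualFourier K) ⊆ closedBall (0 : G) 1) :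
    ∃ f : S0 G, (∀ x, f x = dualFourier K x) ∧ ‖f‖ ≤ dualNorm K := by
  have h0 : dualFourier (0 : CharGroup G → ℂ) = 0 := by ext x; simp [dualFourier]
  have h1 : dualNorm (0 : CharGroup G → ℂ) = 0 := by simp [dualNorm]
  have hsum : HasSum (fun n : ℕ => dualNorm ((Pi.single 0 K : ℕ → CharGroup G → ℂ) n))
      (dualNorm K) := by
    convert hasSum_single (f := fun n : ℕ => dualNorm ((Pi.single 0 K : ℕ → CharGroup G → ℂ) n)) 0
      fun n hn => by rw [Pi.single_eq_of_ne hn, h1] using 1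
    rw [Pi.single_eq_same]
  have hd : IsS0Decomp (dualFourier K) (fun _ => 0) (Pi.single 0 K : ℕ → CharGroup G → ℂ) :=
    { integrable := fun n => by
        rcases eq_or_ne n 0 with rfl | hn
        · rwa [Pi.single_eq_same]
        · rw [Pi.single_eq_of_ne hn]; exact integrable_zero _ _ _
      support := fun n => by
        rcases eq_or_ne n 0 with rfl | hn
        · rwa [Pi.single_eq_same]
        · rw [Pi.single_eq_of_ne hn, h0]; simp
      summable := hsum.summable
      hasSum := fun y => by
        simp only [sub_zero]
        have h := hasSum_single (f := fun n : ℕ =>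
          dualFourier ((Pi.single 0 K : ℕ → CharGroup G → ℂ) n) y) 0
          fun n hn => by rw [Pi.single_eq_of_ne hn, h0]; rfl
        rwa [Pi.single_eq_same] at h }
  exact ⟨S0.ofDecomp hd, fun _ => rfl, (S0.norm_ofDecomp_le hd).trans hsum.tsum_eq.le⟩

section
variable {d : ℕ}

/-- The product of the functions `y_j ↦ ψ(N y_j)`. -/
def boxPlateau (N : ℝ) (y : Euc d) : ℂ := ∏ j, (plateau (N * y j) : ℂ)

/-- Each coordinate is at most `1 / (2N)`; `d + 1` is a convenient bound for `√d`. -/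
lemma norm_le_of_boxPlateau_ne_zero {N : ℝ} (hN : 0 < N) {y : Euc d} (h : boxPlateau N y ≠ 0) :
    ‖y‖ ≤ (d + 1) / (2 * N) := by
  have hj : ∀ j, ‖y j‖ ≤ 1 / (2 * N) := fun j => by
    have h1 : (plateau (N * y j) : ℂ) ≠ 0 := Finset.prod_ne_zero_iff.1 h j (Finset.mem_univ _)
    have h2 : |N * y j| < 1 / 2 := by
      by_contra h3
      exact h1 (by rw [plateau_eq_zero (not_lt.1 h3)]; rfl)
    rw [abs_mul, abs_of_pos hN] at h2
    rw [Real.norm_eq_abs, le_div_iff₀ (by positivity)]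
    linarith
  rw [EuclideanSpace.norm_eq]
  refine Real.sqrt_le_iff.2 ⟨by positivity, ?_⟩
  calc ∑ j, ‖y j‖ ^ 2 ≤ ∑ _j : Fin d, (1 / (2 * N)) ^ 2 :=
        Finset.sum_le_sum fun j _ => pow_le_pow_left₀ (norm_nonneg _) (hj j) 2
    _ = d * (1 / (2 * N)) ^ 2 := by simp
    _ ≤ (d + 1) ^ 2 * (1 / (2 * N)) ^ 2 := by
        gcongr
        nlinarith [(Nat.cast_nonneg d : (0 : ℝ) ≤ d)]
    _ = ((d + 1) / (2 * N)) ^ 2 := by ring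

lemma boxPlateau_zero (N : ℝ) : boxPlateau N (0 : Euc d) = 1 := by
  refine Finset.prod_eq_one fun j _ => ?_
  simp [plateau_eq_one (x := 0) (by norm_num)]

/-- `boxPlateau N` as a Schwartz function. -/
def boxPlateauSchwartz (d : ℕ) {N : ℝ} (hN : 0 < N) : 𝓢(Euc d, ℂ) :=
  HasCompactSupport.toSchwartzMap (f := boxPlateau N)
    (HasCompactSupport.intro (isCompact_closedBall (0 : Euc d) ((d + 1) / (2 * N))) fun y hy => by
      by_contra h
      exact hy (by simpa using norm_le_of_boxPlateau_ne_zero hN h))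
    (contDiff_prod fun j _ => Complex.ofRealCLM.contDiff.comp
      (contDiff_plateau.comp (contDiff_const.mul (EuclideanSpace.proj (𝕜 := ℝ) j).contDiff)))

lemma boxPlateau_eq_integral {N : ℝ} (hN : 0 < N) (y : Euc d) :
    boxPlateau N y = ∫ ξ, 𝓕 (boxPlateauSchwartz d hN) ξ * unitExp (inner ℝ ξ y) := by
  have h : 𝓕⁻ (𝓕 (boxPlateauSchwartz d hN)) = boxPlateauSchwartz d hN :=
    FourierTransform.fourierInv_fourier_eq _
  have h2 := congrArg (fun f : 𝓢(Euc d, ℂ) => f y) h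
  simp only [SchwartzMap.fourierInv_coe, Real.fourierInv_eq] at h2
  change _ = boxPlateau N y at h2
  rw [← h2]
  refine integral_congr_ae (.of_forall fun ξ => ?_)
  simp only [Circle.smul_def, smul_eq_mul, unitExp]
  ring

/-- Modulated translates of `boxPlateau N` have Fourier transforms of the same `L¹` norm. -/
lemma modulate_boxPlateau_eq_integral {N : ℝ} (hN : 0 < N) (η a : Euc d) :
    ∃ P : Euc d → ℂ, Integrable P ∧
      ∫ ξ, ‖P ξ‖ = ∫ ξ, ‖𝓕 (boxPlateauSchwartz d hN) ξ‖ ∧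
      ∀ x, unitExp (inner ℝ η x) * boxPlateau N (x - a) =
        ∫ ξ, P ξ * unitExp (inner ℝ ξ x) := by
  let Q : Euc d → ℂ := fun ζ => 𝓕 (boxPlateauSchwartz d hN) ζ * unitExp (-inner ℝ ζ a)
  have hQ : Integrable Q := integrable_mul_bounded (𝓕 (boxPlateauSchwartz d hN)).integrable
    (by fun_prop : Continuous fun ζ : Euc d => unitExp (-inner ℝ ζ a)).aestronglyMeasurable 1
    fun _ => by simp
  refine ⟨fun ξ => Q (ξ - η), hQ.comp_sub_right η, ?_, fun x => ?_⟩
  · rw [integral_sub_right_eq_self (fun ξ => ‖Q ξ‖) η]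
    simp [Q]
  · rw [boxPlateau_eq_integral hN, ← integral_const_mul,
      ← integral_add_right_eq_self (fun ξ => Q (ξ - η) * unitExp (inner ℝ ξ x)) η]
    refine integral_congr_ae (.of_forall fun ξ => ?_)
    simp only [Q, add_sub_cancel_right, inner_add_left]
    rw [inner_sub_right, sub_eq_add_neg, unitExp_add, unitExp_add]
    ring

lemma boxAtom_eq {N : ℝ} (hN : 0 < N) (i : AtomIndex d) (x : Euc d) :
    boxAtom N i x = unitExp (inner ℝ (WithLp.toLp 2 fun j => N * i.2 j : Euc d) x) *
      boxPlateau N (x - WithLp.toLp 2 fun j => i.1 j / (4 * N)) := by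
  rw [inner_euc, unitExp_sum, boxPlateau, ← Finset.prod_mul_distrib]
  refine Finset.prod_congr rfl fun j _ => ?_
  simp only [PiLp.sub_apply, lineAtom]
  rw [show N * (x j - i.1 j / (4 * N)) = N * x j - i.1 j / 4 by field_simp,
    show (i.2 j : ℝ) * (N * x j) = N * i.2 j * x j by ring, mul_comm]

variable {G : Type} [NormedAddCommGroup G] [ProperSpace G] (e : FreqEmbedding G d)

/-- Uniformity in `η` and `a`: modulation and translation keep the `L¹` norm of the Fourier
transform, and restriction to `G` costs the factor `4`. The condition on `N` makes the bump have
radius at most `1/2`. -/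
lemma FreqEmbedding.exists_modulate_boxPlateau {N : ℝ} (hN : d + 1 ≤ N) :
    ∃ B : ℝ, 0 ≤ B ∧ ∀ η a : Euc d, ∃ f : S0 G, (∀ x, f x =
      unitExp (inner ℝ η (e.emb x)) * boxPlateau N (e.emb x - a)) ∧ ‖f‖ ≤ B := by
  have hN0 : 0 < N := by linarith [(Nat.cast_nonneg d : (0 : ℝ) ≤ d)]
  have hsupp : ∀ y : Euc d, boxPlateau N y ≠ 0 → ‖y‖ ≤ 1 / 2 := fun y hy =>
    (norm_le_of_boxPlateau_ne_zero hN0 hy).trans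
      (by rw [div_le_div_iff₀ (by positivity) two_pos]; linarith)
  have hM : 0 ≤ ∫ ξ, ‖𝓕 (boxPlateauSchwartz d hN0) ξ‖ := integral_nonneg fun _ => norm_nonneg _
  refine ⟨4 * ∫ ξ, ‖𝓕 (boxPlateauSchwartz d hN0) ξ‖, by positivity, fun η a => ?_⟩
  by_cases h : ∃ x₀ : G, ‖e.emb x₀ - a‖ ≤ 1 / 2
  -- The centre `a` need not lie in `G`. Translating by a point `x₀` within `1/2` of it puts the
  -- bump inside the unit ball of `G`.
  · obtain ⟨x₀, hx₀⟩ := h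
    obtain ⟨P, hP, hP1, hP2⟩ := modulate_boxPlateau_eq_integral hN0 η (a - e.emb x₀)
    obtain ⟨K, hK, hK1, hK2⟩ := e.exists_dualFourier hP
    have hKx : ∀ x, dualFourier K x =
        unitExp (inner ℝ η (e.emb x)) * boxPlateau N (e.emb x - (a - e.emb x₀)) := fun x => by
      rw [hK1, hP2]
    obtain ⟨f, hf, hfn⟩ := S0.exists_eq_dualFourier hK fun x hx => by
      have h1 : boxPlateau N (e.emb x - (a - e.emb x₀)) ≠ 0 := fun h0 => by
        rw [Function.mem_support, hKx, h0, mul_zero] at hx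
        exact hx rfl
      have h2 := hsupp _ h1
      rw [mem_closedBall_zero_iff, ← e.norm_emb]
      calc ‖e.emb x‖ = ‖(e.emb x - (a - e.emb x₀)) - (e.emb x₀ - a)‖ := by congr 1; abel
        _ ≤ _ := norm_sub_le _ _
        _ ≤ 1 := by linarith
    refine ⟨unitExp (inner ℝ η (e.emb x₀)) • S0.translate x₀ f, fun x => ?_, ?_⟩
    · change _ * f (x - x₀) = _
      rw [hf, hKx, ← mul_assoc, ← unitExp_add, ← inner_add_right, map_sub]
      congr 2
      · congr 1; abel_nf
      · abel_nf
    · rw [norm_smul, norm_unitExp, one_mul]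
      exact (S0.norm_translate_le _ _).trans (hfn.trans (hK2.trans_eq (by rw [hP1])))
  -- No point of `G` is within `1/2` of `a`, so the bump vanishes on `G`.
  · refine ⟨0, fun x => ?_, by rw [norm_zero]; positivity⟩
    have h0 : boxPlateau N (e.emb x - a) = 0 := by
      by_contra h1
      exact h ⟨x, hsupp _ h1⟩
    rw [h0, mul_zero]
    rfl

/-- The restrictions to `G` of the atoms on `ℝ^d` form a bounded family in `S₀(G)`. -/
lemma FreqEmbedding.exists_atoms {N : ℝ} (hN : d + 1 ≤ N) :
    ∃ B : ℝ, 0 ≤ B ∧ ∃ g : AtomIndex d → S0 G,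
      (∀ i x, g i x = boxAtom N i (e.emb x)) ∧ ∀ i, ‖g i‖ ≤ B := by
  have hN0 : 0 < N := by linarith [(Nat.cast_nonneg d : (0 : ℝ) ≤ d)]
  obtain ⟨B, hB, h⟩ := e.exists_modulate_boxPlateau hN
  choose f hf hfn using h
  exact ⟨B, hB, fun i => f _ _, fun i x => by rw [hf, boxAtom_eq hN0], fun i => hfn _ _⟩

end

/-- `S₀(ℝ^d)` contains bump functions with arbitrarily small support. -/
theorem exists_S0_bump (d : ℕ) {ε : ℝ} (hε : 0 < ε) :
    ∃ φ : S0 (Euc d), φ 0 = 1 ∧ tsupport (φ : Euc d → ℂ) ⊆ ball 0 ε := by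
  obtain ⟨e, he⟩ := exists_freqEmbedding_euc d
  -- Both `d + 1 ≤ N` and `(d + 1) / (2 * N) = ε / (2 * (ε + 1)) < ε` hold for this scale.
  let N : ℝ := (d + 1) * (1 + 1 / ε)
  have hd : (0 : ℝ) < d + 1 := by positivity
  have hN0 : 0 < N := by positivity
  have hN : d + 1 ≤ N := le_mul_of_one_le_right hd.le (by simp [hε.le])
  obtain ⟨B, -, h⟩ := e.exists_modulate_boxPlateau hN
  obtain ⟨φ, hφ, -⟩ := h 0 0
  simp only [inner_zero_left, unitExp_zero, one_mul, sub_zero, he] at hφ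
  refine ⟨φ, by rw [hφ, boxPlateau_zero], ?_⟩
  have hlt : (d + 1) / (2 * N) < ε := by
    rw [div_lt_iff₀ (by positivity)]
    have : ε * (2 * N) = 2 * (d + 1) * (ε + 1) := by simp only [N]; field_simp
    rw [this]
    nlinarith
  refine (closure_minimal ?_ isClosed_closedBall).trans (closedBall_subset_ball hlt)
  intro y hy
  rw [Function.mem_support, hφ] at hy
  simpa using norm_le_of_boxPlateau_ne_zero hN0 hy
end

noncomputable section

/-! ### The coefficients of a function in `S₀(ℝ^d)` -/

section
variable {d : ℕ}

/-- The positions of the cutoff functions that do not vanish identically on the unit ball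
about `x₀`. -/
def nearIndices (N : ℝ) (x₀ : Euc d) : Finset (Fin d → ℤ) :=
  Fintype.piFinset fun j =>
    Finset.Ico (⌊4 * N * x₀ j⌋ - (⌈4 * N⌉₊ + 1)) (⌊4 * N * x₀ j⌋ + (⌈4 * N⌉₊ + 2))

lemma card_nearIndices (N : ℝ) (x₀ : Euc d) :
    (nearIndices N x₀).card = (2 * ⌈4 * N⌉₊ + 3) ^ d := by
  rw [nearIndices, Fintype.card_piFinset]
  have : ∀ j : Fin d, (Finset.Ico (⌊4 * N * x₀ j⌋ - (⌈4 * N⌉₊ + 1))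
      (⌊4 * N * x₀ j⌋ + (⌈4 * N⌉₊ + 2))).card = 2 * ⌈4 * N⌉₊ + 3 := fun j => by
    rw [Int.card_Ico]; omega
  simp [this]

/-- Nonvanishing forces `|4N x j - k j| < 1`, and `x j` is within one of `x₀ j`, so `k j` differs
from `4N x₀ j` by less than `4N + 1`. -/
lemma mem_nearIndices {N : ℝ} (hN : 0 < N) {x₀ x : Euc d} (hx : ‖x - x₀‖ ≤ 1) {k : Fin d → ℤ}
    (h : boxCutoff N k x ≠ 0) : k ∈ nearIndices N x₀ := by
  refine Fintype.mem_piFinset.2 fun j => ?_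
  have h1 : (cutoff (N * x j - k j / 4) : ℂ) ≠ 0 := Finset.prod_ne_zero_iff.1 h j (Finset.mem_univ _)
  have h2 : |N * x j - k j / 4| < 1 / 4 := by
    by_contra h3
    exact h1 (by rw [cutoff_eq_zero (not_lt.1 h3)]; rfl)
  have h3 : |x j - x₀ j| ≤ 1 := (PiLp.norm_apply_le (x - x₀) j).trans hx
  obtain ⟨h4, h5⟩ := abs_lt.1 h2
  obtain ⟨h6, h7⟩ := abs_le.1 h3
  have h8 := Int.floor_le (4 * N * x₀ j)
  have h9 := Int.lt_floor_add_one (4 * N * x₀ j)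
  have h10 := Nat.le_ceil (4 * N)
  have h11 : N * (x j - x₀ j) ≤ N := by nlinarith
  have h12 : -N ≤ N * (x j - x₀ j) := by nlinarith
  rw [Finset.mem_Ico]
  constructor
  · have : ((⌊4 * N * x₀ j⌋ - (⌈4 * N⌉₊ + 1) : ℤ) : ℝ) < k j := by push_cast; linarith
    exact (Int.cast_lt.1 this).le
  · have : (k j : ℝ) < (⌊4 * N * x₀ j⌋ + (⌈4 * N⌉₊ + 2) : ℤ) := by push_cast; linarith
    exact Int.cast_lt.1 this

lemma FreqEmbedding.continuous_dualFourier {G : Type} [NormedAddCommGroup G] [ProperSpace G]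
    (e : FreqEmbedding G d) {F : CharGroup G → ℂ}
    (hF : Integrable F (Measure.haar : Measure (CharGroup G))) : Continuous (dualFourier F) := by
  have h : dualFourier F = pushFourier Measure.haar F e.freq ∘ e.emb :=
    funext fun x => e.dualFourier_eq_pushFourier F x
  rw [h]
  exact (continuous_pushFourier hF e.measurable_freq).comp e.continuous_emb

/-- A uniformly convergent series of continuous functions. Continuity supplies the measurability
needed to integrate `f` against windows. -/
lemma S0.continuous_euc (f : S0 (Euc d)) : Continuous f := by
  obtain ⟨e, -⟩ := exists_freqEmbedding_euc d
  obtain ⟨x, F, h⟩ := f.2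
  have hf : (f : Euc d → ℂ) = fun y => ∑' n, dualFourier (F n) (y - x n) :=
    funext fun y => (h.hasSum y).tsum_eq.symm
  rw [hf]
  exact continuous_tsum (fun n => (e.continuous_dualFourier (h.integrable n)).comp
    (continuous_id.sub continuous_const)) h.summable fun n y => norm_dualFourier_le _ _

lemma S0.integrable_mul_boxWindow {N : ℝ} (hN : 0 < N) (i : AtomIndex d) (f : S0 (Euc d)) :
    Integrable fun y : Fin d → ℝ => f (WithLp.toLp 2 y) * boxWindow N i y := by
  simpa only [mul_comm] using integrable_mul_bounded
    (f := fun y : Fin d → ℝ => f (WithLp.toLp 2 y)) (integrable_boxWindow hN i)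
    (f.continuous_euc.comp (PiLp.continuous_toLp 2 _)).aestronglyMeasurable ‖f‖
    fun y => f.norm_apply_le _

/-- The coefficients of `f ∈ S₀(ℝ^d)` in the atomic expansion. -/
def S0.coeff {N : ℝ} (hN : 0 < N) (i : AtomIndex d) : S0 (Euc d) →ₗ[ℂ] ℂ where
  toFun f := ∫ y : Fin d → ℝ, f (WithLp.toLp 2 y) * boxWindow N i y
  map_add' f g := by
    simp only [S0.add_apply, add_mul]
    exact integral_add (f.integrable_mul_boxWindow hN i) (g.integrable_mul_boxWindow hN i)
  map_smul' c f := by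
    simp only [S0.smul_apply, mul_assoc, integral_const_mul, RingHom.id_apply, smul_eq_mul]

lemma S0.coeff_apply {N : ℝ} (hN : 0 < N) (i : AtomIndex d) (f : S0 (Euc d)) :
    S0.coeff hN i f = ∫ y : Fin d → ℝ, f (WithLp.toLp 2 y) * boxWindow N i y := rfl

/-- The translation becomes a phase on `F`, which leaves `‖F‖` unchanged; estimates are thus uniform
in `x₀`. -/
lemma FreqEmbedding.dualFourier_sub_eq_pushFourier {e : FreqEmbedding (Euc d) d}
    (he : ∀ x, e.emb x = x) (F : CharGroup (Euc d) → ℂ) (x₀ x : Euc d) :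
    dualFourier F (x - x₀) =
      pushFourier Measure.haar (fun χ => F χ * unitExp (-inner ℝ (e.freq χ) x₀)) e.freq x := by
  rw [e.dualFourier_eq_pushFourier, pushFourier, pushFourier, he]
  refine integral_congr_ae (.of_forall fun χ => ?_)
  simp only
  rw [inner_sub_right, sub_eq_add_neg, unitExp_add]
  ring

/-- The coefficients of a translate of a function in the Fourier algebra of `ℝ^d` are summable over
the frequencies, and they belong to the local expansions of this function. -/
lemma dualFourier_translate_coeff {A N : ℝ} (hN : 0 < N)
    (hA : ∀ (k : Fin d → ℤ) (ξ : Euc d),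
      Summable (fun l => ‖boxCoeff N (k, l) ξ‖) ∧ ∑' l, ‖boxCoeff N (k, l) ξ‖ ≤ A)
    {F : CharGroup (Euc d) → ℂ}
    (hF : Integrable F (Measure.haar : Measure (CharGroup (Euc d)))) (x₀ : Euc d)
    (k : Fin d → ℤ) :
    let a := fun l =>
      ∫ y : Fin d → ℝ, dualFourier F (WithLp.toLp 2 y - x₀) * boxWindow N (k, l) y
    Summable (fun l => ‖a l‖) ∧ ∑' l, ‖a l‖ ≤ A * dualNorm F ∧
      ∀ x, HasSum (fun l => a l * boxAtom N (k, l) x)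
        (boxCutoff N k x * dualFourier F (x - x₀)) := by
  intro a
  obtain ⟨e, he⟩ := exists_freqEmbedding_euc d
  have := e.sigmaFinite_haar
  set F' : CharGroup (Euc d) → ℂ := fun χ => F χ * unitExp (-inner ℝ (e.freq χ) x₀) with hF'
  have hF'i : Integrable F' Measure.haar := integrable_mul_bounded hF
    (measurable_unitExp.comp (e.measurable_freq.inner measurable_const).neg).aestronglyMeasurable 1
    fun _ => by simp
  have hnorm : ∫ χ, ‖F' χ‖ ∂Measure.haar = dualNorm F := by simp [hF', dualNorm]
  have ha : a = fun l => pushCoeff Measure.haar F' e.freq N (k, l) := funext fun l => by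
    simp only [a, e.dualFourier_sub_eq_pushFourier he]
    exact integral_pushFourier_mul_boxWindow hN hF'i e.measurable_freq _
  rw [ha]
  refine ⟨summable_norm_pushCoeff hF'i e.measurable_freq N k, ?_, fun x => ?_⟩
  · rw [← hnorm]
    exact tsum_norm_pushCoeff_le hF'i e.measurable_freq (hA k)
  · rw [e.dualFourier_sub_eq_pushFourier he]
    exact hasSum_pushCoeff_mul_boxAtom hN hF'i e.measurable_freq k x

lemma integral_dualFourier_eq_zero {N : ℝ} (hN : 0 < N) {F : CharGroup (Euc d) → ℂ}
    (hF : Function.support (dualFourier F) ⊆ closedBall 0 1) {x₀ : Euc d} {k : Fin d → ℤ}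
    (hk : k ∉ nearIndices N x₀) (l : Fin d → ℤ) :
    ∫ y : Fin d → ℝ, dualFourier F (WithLp.toLp 2 y - x₀) * boxWindow N (k, l) y = 0 := by
  refine integral_eq_zero_of_ae (.of_forall fun y => ?_)
  by_cases h : boxCutoff N k (WithLp.toLp 2 y) = 0
  · simp [boxWindow_eq_zero h]
  · have h1 : dualFourier F (WithLp.toLp 2 y - x₀) = 0 := by
      by_contra h0
      exact hk (mem_nearIndices hN (mem_closedBall_zero_iff.1 (hF h0)) h)
    simp [h1]

/-- Sum and integral may be exchanged because the `n`-th term is bounded by `dualNorm (F n)` times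
an integrable window. -/
lemma IsS0Decomp.hasSum_coeff {f : S0 (Euc d)} {x : ℕ → Euc d} {F : ℕ → CharGroup (Euc d) → ℂ}
    (h : IsS0Decomp (f : Euc d → ℂ) x F) {N : ℝ} (hN : 0 < N) (i : AtomIndex d) :
    HasSum (fun n => ∫ y : Fin d → ℝ, dualFourier (F n) (WithLp.toLp 2 y - x n) * boxWindow N i y)
      (S0.coeff hN i f) := by
  obtain ⟨e, -⟩ := exists_freqEmbedding_euc d
  have hw := integrable_boxWindow hN i
  have hint : ∀ n, Integrable fun y : Fin d → ℝ =>
      dualFourier (F n) (WithLp.toLp 2 y - x n) * boxWindow N i y := fun n => by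
    simpa only [mul_comm] using integrable_mul_bounded
      (f := fun y : Fin d → ℝ => dualFourier (F n) (WithLp.toLp 2 y - x n)) hw
      ((e.continuous_dualFourier (h.integrable n)).comp
        ((PiLp.continuous_toLp 2 _).sub continuous_const)).aestronglyMeasurable
      (dualNorm (F n)) fun y => norm_dualFourier_le _ _
  have hs := hasSum_integral_of_summable_integral_norm (μ := volume) (F := fun n (y : Fin d → ℝ) =>
    dualFourier (F n) (WithLp.toLp 2 y - x n) * boxWindow N i y) hint ?_
  · suffices hv : S0.coeff hN i f = ∫ y : Fin d → ℝ,
        ∑' n, dualFourier (F n) (WithLp.toLp 2 y - x n) * boxWindow N i y by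
      rw [hv]
      exact hs
    rw [S0.coeff_apply]
    refine integral_congr_ae (.of_forall fun y => ?_)
    simp only
    rw [tsum_mul_right, (h.hasSum _).tsum_eq]
  · refine (h.summable.mul_right (∫ y, ‖boxWindow N i y‖)).of_nonneg_of_le
      (fun n => integral_nonneg fun _ => norm_nonneg _) fun n => ?_
    rw [← integral_const_mul]
    refine integral_mono (hint n).norm (hw.norm.const_mul _) fun y => ?_
    simp only [norm_mul]
    gcongr
    exact norm_dualFourier_le _ _

/-- The coefficients of `f ∈ S₀(ℝ^d)` are absolutely summable. -/
theorem S0.exists_coeff_bound (d : ℕ) {N : ℝ} (hN : 0 < N) :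
    ∃ C : ℝ, 0 < C ∧ ∀ f : S0 (Euc d),
      Summable (fun i => ‖S0.coeff hN i f‖) ∧ ∑' i, ‖S0.coeff hN i f‖ ≤ C * ‖f‖ := by
  obtain ⟨A, hA0, hA⟩ := exists_boxCoeff_bound d
  -- The number of positions near a unit ball times the `ℓ¹` bound at each position.
  set M : ℝ := ((2 * ⌈4 * N⌉₊ + 3) ^ d : ℕ) * A with hM
  have hM0 : 0 ≤ M := by positivity
  have key : ∀ (f : S0 (Euc d)) (S : Finset (AtomIndex d)),
      ∑ i ∈ S, ‖S0.coeff hN i f‖ ≤ (M + 1) * ‖f‖ := by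
    intro f S
    -- It suffices to bound the sum by the cost of every decomposition; the `+ 1` keeps the divisor
    -- positive.
    rw [← div_le_iff₀' (by positivity)]
    refine S0.le_norm fun x F h => ?_
    rw [div_le_iff₀' (by positivity)]
    let a : ℕ → AtomIndex d → ℂ := fun n i =>
      ∫ y : Fin d → ℝ, dualFourier (F n) (WithLp.toLp 2 y - x n) * boxWindow N i y
    have hbound : ∀ n, ∑ i ∈ S, ‖a n i‖ ≤ M * dualNorm (F n) := fun n => by
      have hl := fun k => dualFourier_translate_coeff hN (hA N) (h.integrable n) (x n) k
      have hz : ∀ i : AtomIndex d, i.1 ∉ nearIndices N (x n) → ‖a n i‖ = 0 := fun i hi => by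
        rw [norm_eq_zero]
        exact integral_dualFourier_eq_zero hN (h.support n) hi i.2
      classical
      calc ∑ i ∈ S, ‖a n i‖
          ≤ ∑ i ∈ nearIndices N (x n) ×ˢ S.image Prod.snd, ‖a n i‖ := by
            rw [← Finset.sum_filter_of_ne (p := fun i => i.1 ∈ nearIndices N (x n))
              fun i _ hne => by_contra fun hcon => hne (hz i hcon)]
            refine Finset.sum_le_sum_of_subset_of_nonneg (fun i hi => ?_) fun _ _ _ => norm_nonneg _
            rw [Finset.mem_filter] at hi
            exact Finset.mem_product.2 ⟨hi.2, Finset.mem_image_of_mem _ hi.1⟩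
        _ = ∑ k ∈ nearIndices N (x n), ∑ l ∈ S.image Prod.snd, ‖a n (k, l)‖ :=
            Finset.sum_product _ _ _
        _ ≤ ∑ _k ∈ nearIndices N (x n), A * dualNorm (F n) :=
            Finset.sum_le_sum fun k _ =>
              ((hl k).1.sum_le_tsum _ fun _ _ => norm_nonneg _).trans (hl k).2.1
        _ = M * dualNorm (F n) := by
            rw [Finset.sum_const, card_nearIndices, nsmul_eq_mul, hM, mul_assoc]
    have hsumm : ∀ i ∈ S, Summable fun n => ‖a n i‖ := fun i hi =>
      (h.summable.mul_left M).of_nonneg_of_le (fun _ => norm_nonneg _) fun n =>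
        (Finset.single_le_sum (f := fun i => ‖a n i‖) (fun _ _ => norm_nonneg _) hi).trans
          (hbound n)
    calc ∑ i ∈ S, ‖S0.coeff hN i f‖ ≤ ∑ i ∈ S, ∑' n, ‖a n i‖ :=
          Finset.sum_le_sum fun i hi => by
            rw [← (h.hasSum_coeff hN i).tsum_eq]
            exact norm_tsum_le_tsum_norm (hsumm i hi)
      _ = ∑' n, ∑ i ∈ S, ‖a n i‖ := (Summable.tsum_finsetSum hsumm).symm
      _ ≤ ∑' n, (M + 1) * dualNorm (F n) := by
          refine Summable.tsum_le_tsum (fun n => (hbound n).trans ?_) (summable_sum hsumm)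
            (h.summable.mul_left _)
          have := dualNorm_nonneg (F n)
          nlinarith
      _ = (M + 1) * ∑' n, dualNorm (F n) := tsum_mul_left
  refine ⟨M + 1, by positivity, fun f => ?_⟩
  have hs := summable_of_sum_le (fun i => norm_nonneg (S0.coeff hN i f)) (key f)
  exact ⟨hs, hs.tsum_le_of_sum_le (key f)⟩

/-- The absolutely convergent double series over pieces `n` and frequencies `l` is summed in both
orders: first over `l` it reassembles the pieces, first over `n` it gives the coefficients of `f`.
-/
lemma S0.hasSum_coeff_mul_boxAtom_of_position {N : ℝ} (hN : 0 < N) (f : S0 (Euc d))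
    (k : Fin d → ℤ) (z : Euc d) :
    HasSum (fun l => S0.coeff hN (k, l) f * boxAtom N (k, l) z) (boxCutoff N k z * f z) := by
  obtain ⟨A, hA0, hA⟩ := exists_boxCoeff_bound d
  obtain ⟨x, F, h⟩ := f.2
  have hl := fun n => dualFourier_translate_coeff hN (hA N) (h.integrable n) (x n) k
  let a : ℕ → (Fin d → ℤ) → ℂ := fun n l =>
    ∫ y : Fin d → ℝ, dualFourier (F n) (WithLp.toLp 2 y - x n) * boxWindow N (k, l) y
  have hs : Summable fun p : ℕ × (Fin d → ℤ) => ‖a p.1 p.2‖ := by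
    rw [summable_prod_of_nonneg fun p => norm_nonneg _]
    exact ⟨fun n => (hl n).1, (h.summable.mul_left A).of_nonneg_of_le
      (fun n => tsum_nonneg fun _ => norm_nonneg _) fun n => (hl n).2.1⟩
  have hs' : Summable fun p : ℕ × (Fin d → ℤ) => a p.1 p.2 * boxAtom N (k, p.2) z :=
    hs.of_norm_bounded fun p => by
      rw [norm_mul]
      exact mul_le_of_le_one_right (norm_nonneg _) (norm_boxAtom_le _ _ _)
  have h1 := hs'.hasSum.prod_fiberwise fun n => (hl n).2.2 z
  have h2 := (h.hasSum z).mul_left (boxCutoff N k z)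
  have h3 := (Equiv.prodComm _ _).hasSum_iff.2 hs'.hasSum
  have h4 := h3.prod_fiberwise fun l =>
    (h.hasSum_coeff hN (k, l)).mul_right (boxAtom N (k, l) z)
  rwa [h1.unique h2] at h4

/-- The atomic expansion of a function in `S₀(ℝ^d)`. -/
theorem S0.hasSum_coeff_mul_boxAtom {N : ℝ} (hN : 0 < N) (f : S0 (Euc d)) (z : Euc d) :
    HasSum (fun i => S0.coeff hN i f * boxAtom N i z) (f z) := by
  obtain ⟨C, -, hC⟩ := S0.exists_coeff_bound d hN
  have hs : Summable fun i => S0.coeff hN i f * boxAtom N i z :=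
    (hC f).1.of_norm_bounded fun i => by
      rw [norm_mul]
      exact mul_le_of_le_one_right (norm_nonneg _) (norm_boxAtom_le _ _ _)
  have h1 := hs.hasSum.prod_fiberwise fun k => f.hasSum_coeff_mul_boxAtom_of_position hN k z
  have h2 := (hasSum_boxCutoff N z).mul_right (f z)
  rw [one_mul] at h2
  rw [← h1.unique h2]
  exact hs.hasSum

end
end

noncomputable section

/-! ### Restriction to closed subgroups -/

section
variable {d : ℕ}

lemma sum_nearIndices_boxCutoff {N : ℝ} (hN : 0 < N) {x₀ x : Euc d} (hx : ‖x - x₀‖ ≤ 1) :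
    ∑ k ∈ nearIndices N x₀, boxCutoff N k x = 1 :=
  (hasSum_sum_of_ne_finset_zero (f := fun k => boxCutoff N k x) fun k hk => by
    by_contra h
    exact hk (mem_nearIndices hN hx h)).unique (hasSum_boxCutoff N x)

/-- Functions in the Fourier algebra of `G` that are supported in the unit ball extend to functions
in `S₀(ℝ^d)`, with control of the norm. -/
lemma FreqEmbedding.exists_extension {G : Type} [NormedAddCommGroup G] [ProperSpace G]
    (e : FreqEmbedding G d) : ∃ C : ℝ, 0 ≤ C ∧ ∀ K : CharGroup G → ℂ,
      Integrable K (Measure.haar : Measure (CharGroup G)) →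
      Function.support (dualFourier K) ⊆ closedBall (0 : G) 1 →
      ∃ f : S0 (Euc d), (∀ x, f (e.emb x) = dualFourier K x) ∧ ‖f‖ ≤ C * dualNorm K := by
  obtain ⟨e', he'⟩ := exists_freqEmbedding_euc d
  have hN : (0 : ℝ) < d + 1 := by positivity
  obtain ⟨B, hB, g, hg, hgB⟩ := e'.exists_atoms (N := d + 1) le_rfl
  obtain ⟨A, hA0, hA⟩ := exists_boxCoeff_bound d
  refine ⟨(nearIndices (d + 1) (0 : Euc d)).card * (A * B), by positivity, fun K hK hs => ?_⟩
  -- The chosen frequencies turn `dualFourier K` into the Fourier transform of a finite measure on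
  -- `ℝ^d`, whose local expansions have these coefficients.
  let a : AtomIndex d → ℂ := pushCoeff Measure.haar K e.freq (d + 1)
  have hsum : ∀ k, Summable fun l => ‖a (k, l)‖ :=
    summable_norm_pushCoeff hK e.measurable_freq (d + 1)
  have hle : ∀ k l, ‖a (k, l) • g (k, l)‖ ≤ ‖a (k, l)‖ * B := fun k l => by
    rw [norm_smul]; gcongr; exact hgB _
  have hsum' : ∀ k, Summable fun l => a (k, l) • g (k, l) := fun k =>
    ((hsum k).mul_right B).of_norm_bounded (hle k)
  -- The cutoffs at these positions add up to one on the unit ball, and outside it `dualFourier K`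
  -- vanishes on `G`.
  refine ⟨∑ k ∈ nearIndices (d + 1) (0 : Euc d), ∑' l, a (k, l) • g (k, l), fun x => ?_, ?_⟩
  · have hk : ∀ k, (∑' l, a (k, l) • g (k, l)) (e.emb x) =
        boxCutoff (d + 1) k (e.emb x) * dualFourier K x := fun k => by
      rw [e.dualFourier_eq_pushFourier]
      refine (S0.hasSum_apply (hsum' k).hasSum (e.emb x)).unique ?_
      simp only [S0.smul_apply, hg, he']
      exact hasSum_pushCoeff_mul_boxAtom hN hK e.measurable_freq k _
    have hev : (∑ k ∈ nearIndices (d + 1) (0 : Euc d), ∑' l, a (k, l) • g (k, l)) (e.emb x) =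
        ∑ k ∈ nearIndices (d + 1) (0 : Euc d), (∑' l, a (k, l) • g (k, l)) (e.emb x) :=
      map_sum (S0.dirac (e.emb x)) _ _
    rw [hev, Finset.sum_congr rfl fun k _ => hk k, ← Finset.sum_mul]
    by_cases h0 : dualFourier K x = 0
    · rw [h0, mul_zero]
    · have hx : ‖e.emb x - 0‖ ≤ 1 := by
        rw [sub_zero, e.norm_emb]
        exact mem_closedBall_zero_iff.1 (hs h0)
      rw [sum_nearIndices_boxCutoff hN hx, one_mul]
  · calc _ ≤ ∑ k ∈ nearIndices (d + 1) (0 : Euc d), ‖∑' l, a (k, l) • g (k, l)‖ :=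
          norm_sum_le _ _
      _ ≤ ∑ k ∈ nearIndices (d + 1) (0 : Euc d), A * dualNorm K * B := by
          refine Finset.sum_le_sum fun k _ => ?_
          refine (tsum_of_norm_bounded ((hsum k).mul_right B).hasSum (hle k)).trans ?_
          rw [tsum_mul_right]
          gcongr
          exact tsum_norm_pushCoeff_le hK e.measurable_freq (hA _ k)
      _ = _ := by rw [Finset.sum_const, nsmul_eq_mul]; ring

/-- Restriction is a bounded map of `S₀(ℝ^d)` onto `S₀(G)`. -/
theorem FreqEmbedding.exists_restriction {G : Type} [NormedAddCommGroup G] [ProperSpace G]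
    (e : FreqEmbedding G d) : ∃ R : S0 (Euc d) →L[ℂ] S0 G,
      (∀ f x, R f x = f (e.emb x)) ∧ Function.Surjective R := by
  have hN : (0 : ℝ) < d + 1 := by positivity
  obtain ⟨B, hB, g, hg, hgB⟩ := e.exists_atoms (N := d + 1) le_rfl
  obtain ⟨C, -, hC⟩ := S0.exists_coeff_bound d hN
  -- `R` replaces every atom in the expansion by its restriction to `G`.
  obtain ⟨R, hR⟩ := exists_clm_hasSum_smul (S0.coeff hN) (fun f => (hC f).1) (fun f => (hC f).2)
    hB hgB
  have hRx : ∀ f x, R f x = f (e.emb x) := fun f x => by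
    refine (S0.hasSum_apply (hR f) x).unique ?_
    simp only [S0.smul_apply, hg]
    exact f.hasSum_coeff_mul_boxAtom hN _
  refine ⟨R, hRx, fun f => ?_⟩
  obtain ⟨M, hM, hext⟩ := e.exists_extension
  obtain ⟨x, F, h⟩ := f.2
  -- Each piece of a decomposition is extended from the unit ball, then translated back to its
  -- place.
  choose u hu hun using fun n => hext (F n) (h.integrable n) (h.support n)
  have hs : Summable fun n => S0.translate (e.emb (x n)) (u n) :=
    (h.summable.mul_left M).of_norm_bounded fun n => (S0.norm_translate_le _ _).trans (hun n)
  refine ⟨∑' n, S0.translate (e.emb (x n)) (u n), DFunLike.ext _ _ fun z => ?_⟩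
  rw [hRx]
  refine (S0.hasSum_apply hs.hasSum (e.emb z)).unique ?_
  have hz : ∀ n, S0.translate (e.emb (x n)) (u n) (e.emb z) = dualFourier (F n) (z - x n) :=
    fun n => by
      change u n (e.emb z - e.emb (x n)) = _
      rw [← map_sub, hu]
  simp only [hz]
  exact h.hasSum z

/-! ### Samples -/

/-- Functions in `S₀(G)` are absolutely summable over subgroups with finitely many points in
bounded sets. -/
theorem S0.exists_sample_bound {G : Type} [NormedAddCommGroup G] [ProperSpace G] {Γ : Type*}
    [AddCommGroup Γ] (p : Γ →+ G) (hp : {γ | ‖p γ‖ ≤ 2}.Finite) :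
    ∃ C : ℝ, 0 < C ∧ ∀ f : S0 G,
      Summable (fun γ => ‖f (p γ)‖) ∧ ∑' γ, ‖f (p γ)‖ ≤ C * ‖f‖ := by
  classical
  let M : ℕ := hp.toFinset.card
  -- Subtracting one fixed point of the ball about `z` maps the others injectively into `{γ | ‖p γ‖
  -- ≤ 2}`, so the count is independent of `z`.
  have hcount : ∀ (S : Finset Γ) (z : G), (S.filter fun γ => ‖p γ - z‖ ≤ 1).card ≤ M := by
    intro S z
    rcases (S.filter fun γ => ‖p γ - z‖ ≤ 1).eq_empty_or_nonempty with h | ⟨γ₀, hγ₀⟩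
    · rw [h]; exact Nat.zero_le _
    · refine Finset.card_le_card_of_injOn (fun γ => γ - γ₀) (fun γ hγ => ?_)
        fun _ _ _ _ h => sub_left_injective h
      have h1 := (Finset.mem_filter.1 hγ).2
      have h2 := (Finset.mem_filter.1 hγ₀).2
      refine hp.mem_toFinset.2 ?_
      calc ‖p (γ - γ₀)‖ = ‖(p γ - z) - (p γ₀ - z)‖ := by rw [map_sub]; congr 1; abel
        _ ≤ _ := norm_sub_le _ _
        _ ≤ 2 := by linarith
  have key : ∀ (f : S0 G) (S : Finset Γ), ∑ γ ∈ S, ‖f (p γ)‖ ≤ (M + 1) * ‖f‖ := by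
    intro f S
    rw [← div_le_iff₀' (by positivity)]
    refine S0.le_norm fun x F h => ?_
    rw [div_le_iff₀' (by positivity)]
    have hbound : ∀ n, ∑ γ ∈ S, ‖dualFourier (F n) (p γ - x n)‖ ≤ M * dualNorm (F n) := fun n => by
      calc ∑ γ ∈ S, ‖dualFourier (F n) (p γ - x n)‖
          = ∑ γ ∈ S.filter fun γ => ‖p γ - x n‖ ≤ 1, ‖dualFourier (F n) (p γ - x n)‖ :=
            (Finset.sum_filter_of_ne fun γ _ hne => mem_closedBall_zero_iff.1
              (h.support n (norm_ne_zero_iff.1 hne))).symm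
        _ ≤ ∑ γ ∈ S.filter fun γ => ‖p γ - x n‖ ≤ 1, dualNorm (F n) :=
            Finset.sum_le_sum fun _ _ => norm_dualFourier_le _ _
        _ ≤ M * dualNorm (F n) := by
            rw [Finset.sum_const, nsmul_eq_mul]
            have := dualNorm_nonneg (F n)
            gcongr
            exact hcount S (x n)
    have hsumm : ∀ γ ∈ S, Summable fun n => ‖dualFourier (F n) (p γ - x n)‖ := fun γ _ =>
      h.summable.of_nonneg_of_le (fun _ => norm_nonneg _) fun n => norm_dualFourier_le _ _
    calc ∑ γ ∈ S, ‖f (p γ)‖ ≤ ∑ γ ∈ S, ∑' n, ‖dualFourier (F n) (p γ - x n)‖ :=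
          Finset.sum_le_sum fun γ hγ => by
            rw [← (h.hasSum (p γ)).tsum_eq]
            exact norm_tsum_le_tsum_norm (hsumm γ hγ)
      _ = ∑' n, ∑ γ ∈ S, ‖dualFourier (F n) (p γ - x n)‖ := (Summable.tsum_finsetSum hsumm).symm
      _ ≤ ∑' n, (M + 1) * dualNorm (F n) := by
          refine Summable.tsum_le_tsum (fun n => (hbound n).trans ?_) (summable_sum hsumm)
            (h.summable.mul_left _)
          have := dualNorm_nonneg (F n)
          nlinarith
      _ = (M + 1) * ∑' n, dualNorm (F n) := tsum_mul_left
  refine ⟨M + 1, by positivity, fun f => ?_⟩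
  have hs := summable_of_sum_le (fun γ => norm_nonneg (f (p γ))) (key f)
  exact ⟨hs, hs.tsum_le_of_sum_le (key f)⟩

theorem S0.exists_int_sample_bound (d : ℕ) : ∃ C : ℝ, 0 < C ∧ ∀ f : S0 (Euc d),
    Summable (fun n : Fin d → ℤ => ‖f (intPoint n)‖) ∧
      ∑' n : Fin d → ℤ, ‖f (intPoint n)‖ ≤ C * ‖f‖ := by
  let p : (Fin d → ℤ) →+ Euc d :=
    { toFun := intPoint
      map_zero' := by ext j; simp [intPoint]
      map_add' := fun m n => by ext j; simp [intPoint] }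
  refine S0.exists_sample_bound p ((Set.finite_Icc (fun _ => -2) fun _ => 2).subset fun n hn => ?_)
  have hj : ∀ j, |(n j : ℝ)| ≤ 2 := fun j =>
    (PiLp.norm_apply_le (intPoint n) j).trans hn
  have hj' : ∀ j, |n j| ≤ 2 := fun j => by exact_mod_cast hj j
  exact ⟨fun j => (abs_le.1 (hj' j)).1, fun j => (abs_le.1 (hj' j)).2⟩

theorem S0.exists_lattice_sample_bound (L : Submodule ℤ (Euc d)) [DiscreteTopology L] :
    ∃ C : ℝ, 0 < C ∧ ∀ f : S0 (Euc d),
      Summable (fun l : L => ‖f (l : Euc d)‖) ∧ ∑' l : L, ‖f (l : Euc d)‖ ≤ C * ‖f‖ := by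
  refine S0.exists_sample_bound (L.subtype : L →+ Euc d) ?_
  have hdisc : DiscreteTopology L.toAddSubgroup := (inferInstance : DiscreteTopology L)
  have hfin : (closedBall (0 : Euc d) 2 ∩ L.toAddSubgroup).Finite :=
    Metric.finite_isBounded_inter_isClosed DiscreteTopology.isDiscrete isBounded_closedBall
      inferInstance
  refine Set.Finite.of_finite_image (f := Subtype.val) (hfin.subset ?_)
    Subtype.val_injective.injOn
  rintro _ ⟨l, hl, rfl⟩
  exact ⟨mem_closedBall_zero_iff.2 hl, l.2⟩

/-! ### Extension from a lattice -/

lemma summable_norm_lp_one {ι : Type*} (c : lp (fun _ : ι => ℂ) 1) : Summable fun i => ‖c i‖ := by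
  simpa using (lp.memℓp c).summable (by simp)

lemma tsum_norm_lp_one {ι : Type*} (c : lp (fun _ : ι => ℂ) 1) : ∑' i, ‖c i‖ = ‖c‖ := by
  rw [lp.norm_eq_tsum_rpow (by simp)]
  simp

/-- Semidiscrete convolution with a function that vanishes on all nonzero lattice points extends
`ℓ¹` sequences from the lattice. -/
theorem S0.exists_semidiscrete_convolution (L : Submodule ℤ (Euc d)) (φ : S0 (Euc d))
    (h0 : φ 0 = 1) (hφ : tsupport (φ : Euc d → ℂ) ∩ (L : Set (Euc d)) ⊆ {0}) :
    ∃ E : lp (fun _ : L => ℂ) 1 →L[ℂ] S0 (Euc d), ∀ c : lp (fun _ : L => ℂ) 1,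
      HasSum (fun l : L => c l • S0.translate (l : Euc d) φ) (E c) ∧
      (∃ σ : StrongDual ℂ (S0 (Euc d)),
        HasSum (fun l : L => c l • S0.dirac (l : Euc d)) σ ∧
        ∀ x : Euc d, E c x = S0.conv σ φ x) ∧
      ∀ l : L, E c (l : Euc d) = c l := by
  let ev : L → lp (fun _ : L => ℂ) 1 →ₗ[ℂ] ℂ := fun l =>
    { toFun := fun c => c l, map_add' := fun _ _ => rfl, map_smul' := fun _ _ => rfl }
  have hle : ∀ c : lp (fun _ : L => ℂ) 1, ∑' l, ‖ev l c‖ ≤ 1 * ‖c‖ := fun c => by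
    rw [one_mul]; exact (tsum_norm_lp_one c).le
  obtain ⟨E, hE⟩ := exists_clm_hasSum_smul ev summable_norm_lp_one hle (norm_nonneg φ)
    fun l : L => S0.norm_translate_le (l : Euc d) φ
  -- The same coefficients applied to Dirac measures, which have norm at most one, give norm
  -- convergence in the dual.
  obtain ⟨D, hD⟩ := exists_clm_hasSum_smul ev summable_norm_lp_one hle zero_le_one
    fun l : L => S0.norm_dirac_le (l : Euc d)
  refine ⟨E, fun c => ⟨hE c, ⟨D c, hD c, fun x => ?_⟩, fun l => ?_⟩⟩
  · have h1 := S0.hasSum_apply (hE c) x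
    have h2 := (hD c).mapL
      (ContinuousLinearMap.apply ℂ ℂ (S0.translate x (S0.reflect φ)))
    have h3 : ∀ l : L, (ev l c • S0.translate (l : Euc d) φ) x =
        ContinuousLinearMap.apply ℂ ℂ (S0.translate x (S0.reflect φ))
          (ev l c • S0.dirac (l : Euc d)) := fun l => by
      change c l * φ (x - l) = c l * φ (-(l - x))
      rw [neg_sub]
    simp only [h3] at h1
    exact h1.unique h2
  · refine (S0.hasSum_apply (hE c) l).unique ?_
    have h1 := hasSum_single (f := fun l' : L => (ev l' c • S0.translate (l' : Euc d) φ) (l : Euc d))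
      l fun l' hl' => ?_
    · convert h1 using 1
      change _ = c l * φ ((l : Euc d) - l)
      rw [sub_self, h0, mul_one]
    · change c l' * φ ((l : Euc d) - l') = 0
      -- A difference of lattice points is a lattice point, so the support condition leaves only `l'
      -- = l`.
      have h2 : φ ((l : Euc d) - l') = 0 := by
        by_contra hne
        have h3 : ((l : Euc d) - l') ∈ ({0} : Set (Euc d)) :=
          hφ ⟨subset_tsupport _ hne, L.sub_mem l.2 l'.2⟩
        exact hl' (Subtype.ext (sub_eq_zero.1 h3).symm)
      rw [h2, mul_zero]

end
end

noncomputable section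

/-! ### Tensor products -/

section
variable {k m : ℕ}

/-- Atoms on `ℝ^(k+m)` are tensor products of atoms on `ℝ^k` and on `ℝ^m`. -/
def splitIndex (k m : ℕ) : AtomIndex (k + m) ≃ AtomIndex k × AtomIndex m where
  toFun i := ((fun j => i.1 (Fin.castAdd m j), fun j => i.2 (Fin.castAdd m j)),
    (fun j => i.1 (Fin.natAdd k j), fun j => i.2 (Fin.natAdd k j)))
  invFun p := (Fin.append p.1.1 p.2.1, Fin.append p.1.2 p.2.2)
  left_inv i := by
    ext j <;> refine Fin.addCases (fun j => ?_) (fun j => ?_) j <;> simp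
  right_inv p := by ext j <;> simp

lemma boxAtom_split (N : ℝ) (i : AtomIndex (k + m)) (x : Euc (k + m)) :
    boxAtom N i x = boxAtom N (splitIndex k m i).1 (headCoords rfl x) *
      boxAtom N (splitIndex k m i).2 (tailCoords rfl x) := by
  simp only [boxAtom, Fin.prod_univ_add]
  rfl

lemma boxWindow_split (N : ℝ) (i : AtomIndex (k + m)) (y : Fin (k + m) → ℝ) :
    boxWindow N i y = boxWindow N (splitIndex k m i).1 (fun j => y (Fin.castAdd m j)) *
      boxWindow N (splitIndex k m i).2 (fun j => y (Fin.natAdd k j)) := by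
  simp only [boxWindow, Fin.prod_univ_add]
  rfl

/-- Fubini, through the measure preserving identification of `ℝ^(k+m)` with `ℝ^k × ℝ^m`. -/
lemma integral_head_mul_tail (a : (Fin k → ℝ) → ℂ) (b : (Fin m → ℝ) → ℂ) :
    ∫ y : Fin (k + m) → ℝ, a (fun j => y (Fin.castAdd m j)) * b (fun j => y (Fin.natAdd k j)) =
      (∫ y, a y) * ∫ y, b y := by
  let e := (MeasurableEquiv.piCongrLeft (fun _ : Fin (k + m) => ℝ) finSumFinEquiv).symm.trans
    (MeasurableEquiv.sumPiEquivProdPi fun _ : Fin k ⊕ Fin m => ℝ)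
  have he : MeasurePreserving e volume volume :=
    ((volume_measurePreserving_piCongrLeft (fun _ : Fin (k + m) => ℝ) finSumFinEquiv).symm _).trans
      (volume_measurePreserving_sumPiEquivProdPi fun _ : Fin k ⊕ Fin m => ℝ)
  have h := he.integral_comp' (g := fun p => a p.1 * b p.2)
  rw [← integral_prod_mul]
  exact h

/-- Windows factor like atoms, so the coefficient integral of a product splits. This identifies the
inverse map on elementary tensors. -/
lemma S0.coeff_eq_mul {N : ℝ} (hN : 0 < N) {f : S0 (Euc k)} {g : S0 (Euc m)}
    {u : S0 (Euc (k + m))} (hu : ∀ x, u x = f (headCoords rfl x) * g (tailCoords rfl x))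
    (i : AtomIndex (k + m)) :
    S0.coeff hN i u = S0.coeff hN (splitIndex k m i).1 f * S0.coeff hN (splitIndex k m i).2 g := by
  simp only [S0.coeff_apply]
  rw [← integral_head_mul_tail]
  refine integral_congr_ae (.of_forall fun y => ?_)
  simp only [boxWindow_split, hu]
  rw [mul_mul_mul_comm]
  rfl

lemma hasSum_mul_complex {ι κ : Type*} {a : ι → ℂ} {b : κ → ℂ} {s t : ℂ} (ha : HasSum a s)
    (hb : HasSum b t) : HasSum (fun p : ι × κ => a p.1 * b p.2) (s * t) :=
  ha.mul hb (summable_mul_of_summable_norm ha.summable.norm hb.summable.norm)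

/-- The bounded bilinear map `(f, g) ↦ f ⊗ g`. -/
theorem S0.exists_tensor (k m : ℕ) :
    ∃ T : S0 (Euc k) →L[ℂ] S0 (Euc m) →L[ℂ] S0 (Euc (k + m)),
      ∀ f g x, T f g x = f (headCoords rfl x) * g (tailCoords rfl x) := by
  obtain ⟨e, he⟩ := exists_freqEmbedding_euc (k + m)
  obtain ⟨N, hN, hNle⟩ : ∃ N : ℝ, 0 < N ∧ (k + m : ℕ) + 1 ≤ N := ⟨_, by positivity, le_rfl⟩
  obtain ⟨B, hB, G, hG, hGB⟩ := e.exists_atoms hNle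
  obtain ⟨C, hC0, hC⟩ := S0.exists_coeff_bound k hN
  obtain ⟨D, hD0, hD⟩ := S0.exists_coeff_bound m hN
  have key : ∀ (f : S0 (Euc k)) (g : S0 (Euc m)), ∃ u : S0 (Euc (k + m)),
      (∀ x, u x = f (headCoords rfl x) * g (tailCoords rfl x)) ∧
        ‖u‖ ≤ C * D * B * ‖f‖ * ‖g‖ := by
    intro f g
    obtain ⟨a, ha, hale, hax⟩ : ∃ a : AtomIndex k → ℂ, Summable (fun i => ‖a i‖) ∧
        ∑' i, ‖a i‖ ≤ C * ‖f‖ ∧ ∀ x, HasSum (fun i => a i * boxAtom N i x) (f x) :=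
      ⟨fun i => S0.coeff hN i f, (hC f).1, (hC f).2, f.hasSum_coeff_mul_boxAtom hN⟩
    obtain ⟨b, hb, hble, hbx⟩ : ∃ b : AtomIndex m → ℂ, Summable (fun i => ‖b i‖) ∧
        ∑' i, ‖b i‖ ≤ D * ‖g‖ ∧ ∀ x, HasSum (fun i => b i * boxAtom N i x) (g x) :=
      ⟨fun i => S0.coeff hN i g, (hD g).1, (hD g).2, g.hasSum_coeff_mul_boxAtom hN⟩
    -- Multiplying the two expansions gives an `ℓ¹` combination of atoms on `ℝ^(k+m)`, whose norms
    -- are bounded by `B`.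
    let c : AtomIndex k × AtomIndex m → ℂ := fun p => a p.1 * b p.2
    have hc : Summable fun p => ‖c p‖ := ha.mul_norm hb
    have hcle : ∑' p, ‖c p‖ ≤ (C * ‖f‖) * (D * ‖g‖) := by
      simp only [c, norm_mul]
      rw [← tsum_mul_tsum_of_summable_norm ha.norm hb.norm]
      exact mul_le_mul hale hble (tsum_nonneg fun _ => norm_nonneg _) (by positivity)
    have hle : ∀ p, ‖c p • G ((splitIndex k m).symm p)‖ ≤ ‖c p‖ * B := fun p => by
      rw [norm_smul]; gcongr; exact hGB _
    have hs : Summable fun p => c p • G ((splitIndex k m).symm p) :=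
      (hc.mul_right B).of_norm_bounded hle
    refine ⟨∑' p, c p • G ((splitIndex k m).symm p), fun x => ?_, ?_⟩
    · refine (S0.hasSum_apply hs.hasSum x).unique ?_
      have h3 := hasSum_mul_complex (hax (headCoords rfl x)) (hbx (tailCoords rfl x))
      have h4 : ∀ p, (c p • G ((splitIndex k m).symm p)) x =
          a p.1 * boxAtom N p.1 (headCoords rfl x) * (b p.2 * boxAtom N p.2 (tailCoords rfl x)) :=
        fun p => by
          rw [S0.smul_apply, hG, he, boxAtom_split, Equiv.apply_symm_apply]
          exact mul_mul_mul_comm _ _ _ _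
      simp only [h4]
      exact h3
    · refine (tsum_of_norm_bounded (hc.mul_right B).hasSum hle).trans ?_
      rw [tsum_mul_right]
      calc _ ≤ (C * ‖f‖) * (D * ‖g‖) * B := by gcongr
        _ = _ := by ring
  choose u hu hun using key
  refine ⟨LinearMap.mkContinuous₂ (LinearMap.mk₂ ℂ u ?_ ?_ ?_ ?_) (C * D * B) fun f g => ?_,
    fun f g x => hu f g x⟩
  · intro f f' g
    exact DFunLike.ext _ _ fun x => by simp only [S0.add_apply, hu]; ring
  · intro c f g
    exact DFunLike.ext _ _ fun x => by simp only [S0.smul_apply, hu]; ring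
  · intro f g g'
    exact DFunLike.ext _ _ fun x => by simp only [S0.add_apply, hu]; ring
  · intro c f g
    exact DFunLike.ext _ _ fun x => by simp only [S0.smul_apply, hu]; ring
  · exact hun f g

/-- The double series converges absolutely; summing it first over `j` and then over `i` identifies
its value. -/
lemma hasSum_bilinear {X Y Z ι κ : Type*} [NormedAddCommGroup X] [NormedSpace ℂ X]
    [NormedAddCommGroup Y] [NormedSpace ℂ Y] [NormedAddCommGroup Z] [NormedSpace ℂ Z]
    [CompleteSpace Z] (T : X →L[ℂ] Y →L[ℂ] Z) {a : ι → ℂ} {v : ι → X} {f : X} {b : κ → ℂ}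
    {w : κ → Y} {g : Y} {B D : ℝ} (ha : Summable fun i => ‖a i‖) (hv : ∀ i, ‖v i‖ ≤ B)
    (hf : HasSum (fun i => a i • v i) f) (hb : Summable fun i => ‖b i‖) (hw : ∀ i, ‖w i‖ ≤ D)
    (hg : HasSum (fun i => b i • w i) g) :
    HasSum (fun p : ι × κ => (a p.1 * b p.2) • T (v p.1) (w p.2)) (T f g) := by
  have hs : Summable fun p : ι × κ => (a p.1 * b p.2) • T (v p.1) (w p.2) := by
    refine ((ha.mul_norm hb).mul_right (‖T‖ * B * D)).of_norm_bounded fun p => ?_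
    rw [norm_smul]
    gcongr
    exact (T.le_opNorm₂ _ _).trans (by
      have := (norm_nonneg _).trans (hv p.1)
      gcongr
      exacts [hv _, hw _])
  have h1 : ∀ i, HasSum (fun j => (a i * b j) • T (v i) (w j)) (T (a i • v i) g) := fun i => by
    have h := hg.mapL (T (a i • v i))
    simpa [smul_smul, mul_comm] using h
  have h2 := hs.hasSum.prod_fiberwise h1
  have h3 : HasSum (fun i => T (a i • v i) g) (T f g) := by
    simpa using hf.mapL (T.flip g)
  rw [← h2.unique h3]
  exact hs.hasSum

lemma elemTensor_add_left (f f' : S0 (Euc k)) (g : S0 (Euc m)) :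
    elemTensor (f + f') g = elemTensor f g + elemTensor f' g := by
  rw [elemTensor, elemTensor, elemTensor, ← UniformSpace.Completion.coe_add]
  congr 1
  exact MultilinearMap.cons_add (M := fun i : Fin 2 => S0 (Euc (![k, m] i)))
    (PiTensorProduct.tprod ℂ) (Fin.cons g finZeroElim) f f'

lemma elemTensor_smul_left (c : ℂ) (f : S0 (Euc k)) (g : S0 (Euc m)) :
    elemTensor (c • f) g = c • elemTensor f g := by
  rw [elemTensor, elemTensor, ← UniformSpace.Completion.coe_smul]
  congr 1
  exact MultilinearMap.cons_smul (M := fun i : Fin 2 => S0 (Euc (![k, m] i)))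
    (PiTensorProduct.tprod ℂ) (Fin.cons g finZeroElim) c f

/-- Currying away the first factor makes the second one the leading argument, where
`MultilinearMap.cons_add` applies. -/
lemma elemTensor_add_right (f : S0 (Euc k)) (g g' : S0 (Euc m)) :
    elemTensor f (g + g') = elemTensor f g + elemTensor f g' := by
  rw [elemTensor, elemTensor, elemTensor, ← UniformSpace.Completion.coe_add]
  congr 1
  exact MultilinearMap.cons_add (M := fun i : Fin 1 => S0 (Euc (![k, m] i.succ)))
    (MultilinearMap.curryLeft (M := fun i : Fin 2 => S0 (Euc (![k, m] i)))
      (PiTensorProduct.tprod ℂ) f) finZeroElim g g'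

lemma elemTensor_smul_right (c : ℂ) (f : S0 (Euc k)) (g : S0 (Euc m)) :
    elemTensor f (c • g) = c • elemTensor f g := by
  rw [elemTensor, elemTensor, ← UniformSpace.Completion.coe_smul]
  congr 1
  exact MultilinearMap.cons_smul (M := fun i : Fin 1 => S0 (Euc (![k, m] i.succ)))
    (MultilinearMap.curryLeft (M := fun i : Fin 2 => S0 (Euc (![k, m] i)))
      (PiTensorProduct.tprod ℂ) f) finZeroElim c g

lemma norm_elemTensor_le (f : S0 (Euc k)) (g : S0 (Euc m)) :
    ‖elemTensor f g‖ ≤ ‖f‖ * ‖g‖ := by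
  rw [elemTensor, UniformSpace.Completion.norm_coe]
  refine (PiTensorProduct.projectiveSeminorm_tprod_le _).trans_eq ?_
  rw [Fin.prod_univ_two]
  rfl

/-- `elemTensor` as a bounded bilinear map. -/
def elemTensorL (k m : ℕ) : S0 (Euc k) →L[ℂ] S0 (Euc m) →L[ℂ] ProjTensorS0 k m :=
  LinearMap.mkContinuous₂ (LinearMap.mk₂ ℂ elemTensor elemTensor_add_left elemTensor_smul_left
    elemTensor_add_right elemTensor_smul_right) 1 fun f g => by
      rw [one_mul]; exact norm_elemTensor_le f g

lemma coe_tprod_eq_elemTensor (v : ∀ i : Fin 2, S0 (Euc (![k, m] i))) :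
    ((PiTensorProduct.tprod ℂ v : ⨂[ℂ] i : Fin 2, S0 (Euc (![k, m] i))) : ProjTensorS0 k m) =
      elemTensor (v 0 : S0 (Euc k)) (v 1 : S0 (Euc m)) := by
  rw [elemTensor]
  congr 2
  funext i
  refine Fin.cases rfl (fun i => ?_) i
  rw [Subsingleton.elim i 0]
  rfl

/-- The linearization of a bounded bilinear map on the projective tensor product. -/
lemma exists_clm_elemTensor {E : Type} [NormedAddCommGroup E] [NormedSpace ℂ E] [CompleteSpace E]
    (T : S0 (Euc k) →L[ℂ] S0 (Euc m) →L[ℂ] E) :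
    ∃ Φ : ProjTensorS0 k m →L[ℂ] E, ∀ f g, Φ (elemTensor f g) = T f g := by
  let A : MultilinearMap ℂ (fun i : Fin 2 => S0 (Euc (![k, m] i))) E :=
    { toFun := fun v => T (v 0 : S0 (Euc k)) (v 1 : S0 (Euc m))
      map_update_add' := fun v i x y => by
        revert i
        refine Fin.forall_fin_two.2 ⟨fun x y => ?_, fun x y => ?_⟩
        · simp only [Function.update_self, ne_eq, one_ne_zero, not_false_eq_true,
            Function.update_of_ne]
          exact DFunLike.congr_fun (T.map_add _ _) (v 1 : S0 (Euc m))
        · simp only [Function.update_self, ne_eq, zero_ne_one, not_false_eq_true,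
            Function.update_of_ne]
          exact (T _).map_add _ _
      map_update_smul' := fun v i c x => by
        revert i
        refine Fin.forall_fin_two.2 ⟨fun x => ?_, fun x => ?_⟩
        · simp only [Function.update_self, ne_eq, one_ne_zero, not_false_eq_true,
            Function.update_of_ne]
          exact DFunLike.congr_fun (T.map_smul _ _) (v 1 : S0 (Euc m))
        · simp only [Function.update_self, ne_eq, zero_ne_one, not_false_eq_true,
            Function.update_of_ne]
          exact (T _).map_smul _ _ }
  let A' := A.mkContinuous ‖T‖ fun v => by
    rw [Fin.prod_univ_two, ← mul_assoc]
    exact T.le_opNorm₂ _ _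
  let Φ₀ := PiTensorProduct.liftIsometry ℂ _ _ A'
  refine ⟨Φ₀.extend UniformSpace.Completion.toComplL, fun f g => ?_⟩
  have h := Φ₀.extend_eq (e := UniformSpace.Completion.toComplL)
    UniformSpace.Completion.denseRange_coe
    (UniformSpace.Completion.isUniformInducing_coe _)
    (PiTensorProduct.tprod ℂ
    (Fin.cons f (Fin.cons g finZeroElim) : ∀ i : Fin 2, S0 (Euc (![k, m] i))))
  refine h.trans ?_
  simp only [Φ₀, PiTensorProduct.liftIsometry_apply_apply, PiTensorProduct.lift.tprod]
  rfl

/-- Elementary tensors span the algebraic tensor product, which is dense in its completion. -/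
lemma projTensorS0_ext {E : Type} [NormedAddCommGroup E] [NormedSpace ℂ E]
    {S T : ProjTensorS0 k m →L[ℂ] E} (h : ∀ f g, S (elemTensor f g) = T (elemTensor f g)) :
    S = T := by
  refine ContinuousLinearMap.ext fun z => ?_
  refine UniformSpace.Completion.induction_on z (isClosed_eq S.continuous T.continuous) fun t => ?_
  have h1 : (S ∘L UniformSpace.Completion.toComplL).toLinearMap =
      (T ∘L UniformSpace.Completion.toComplL).toLinearMap :=
    PiTensorProduct.ext (MultilinearMap.ext fun v => by
      have h2 := coe_tprod_eq_elemTensor v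
      exact (congrArg S h2).trans ((h _ _).trans (congrArg T h2).symm))
  exact LinearMap.congr_fun h1 t

/-- `S₀(ℝ^(k+m))` is the projective tensor product of `S₀(ℝ^k)` and `S₀(ℝ^m)`. -/
theorem S0.exists_projTensor_equiv (k m : ℕ) :
    ∃ Φ : ProjTensorS0 k m ≃L[ℂ] S0 (Euc (k + m)), ∀ f g x,
      Φ (elemTensor f g) x = f (headCoords rfl x) * g (tailCoords rfl x) := by
  obtain ⟨T, hT⟩ := S0.exists_tensor k m
  obtain ⟨Φ, hΦ⟩ := exists_clm_elemTensor T
  -- One scale for both factors and the product, so that the boxes factor.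
  obtain ⟨N, hN, hk, hm⟩ : ∃ N : ℝ, 0 < N ∧ (k : ℝ) + 1 ≤ N ∧ (m : ℝ) + 1 ≤ N :=
    ⟨k + m + 1, by positivity, by simp, by simp⟩
  obtain ⟨ek, hek⟩ := exists_freqEmbedding_euc k
  obtain ⟨em, hem⟩ := exists_freqEmbedding_euc m
  obtain ⟨B, hB, G, hG, hGB⟩ := ek.exists_atoms hk
  obtain ⟨D, hD, K, hK, hKD⟩ := em.exists_atoms hm
  -- The atomic expansion converges in the norm of `S0`, because it converges absolutely and its
  -- pointwise sum is `f`.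
  have hexp : ∀ {n : ℕ} {B : ℝ} {g : AtomIndex n → S0 (Euc n)}, 0 ≤ B →
      (∀ i x, g i x = boxAtom N i x) → (∀ i, ‖g i‖ ≤ B) →
      ∀ f, HasSum (fun i => S0.coeff hN i f • g i) f := by
    intro n B g hB hg hgB f
    obtain ⟨C, -, hC⟩ := S0.exists_coeff_bound n hN
    obtain ⟨R, hR⟩ := exists_clm_hasSum_smul (S0.coeff hN) (fun f => (hC f).1)
      (fun f => (hC f).2) hB hgB
    have hRf : R f = f := DFunLike.ext _ _ fun x => by
      refine (S0.hasSum_apply (hR f) x).unique ?_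
      simp only [S0.smul_apply, hg]
      exact f.hasSum_coeff_mul_boxAtom hN x
    rw [← hRf]
    convert hR f using 1
    rw [hRf]
  obtain ⟨C, -, hC⟩ := S0.exists_coeff_bound (k + m) hN
  -- The candidate inverse replaces each atom on `ℝ^(k+m)` by the elementary tensor of its two
  -- factors.
  obtain ⟨Ψ, hΨ⟩ := exists_clm_hasSum_smul (S0.coeff hN) (fun f => (hC f).1) (fun f => (hC f).2)
    (mul_nonneg hB hD)
    (v := fun i => elemTensor (G (splitIndex k m i).1) (K (splitIndex k m i).2)) fun i =>
      (norm_elemTensor_le _ _).trans (mul_le_mul (hGB _) (hKD _) (norm_nonneg _) hB)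
  have h1 : ∀ u, Φ (Ψ u) = u := fun u => DFunLike.ext _ _ fun x => by
    refine (S0.hasSum_apply ((hΨ u).mapL Φ) x).unique ?_
    simp only [map_smul, hΦ, S0.smul_apply, hT, hG, hK, hek, hem]
    simp only [← boxAtom_split]
    exact u.hasSum_coeff_mul_boxAtom hN x
  -- On `f ⊗ g` the coefficients of the product are products of coefficients, so `Ψ` yields the
  -- double expansion of `elemTensor f g`.
  have h2 : Ψ ∘L Φ = ContinuousLinearMap.id ℂ _ := projTensorS0_ext fun f g => by
    change Ψ (Φ (elemTensor f g)) = elemTensor f g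
    obtain ⟨C, -, hC⟩ := S0.exists_coeff_bound k hN
    obtain ⟨C', -, hC'⟩ := S0.exists_coeff_bound m hN
    have h3 := hasSum_bilinear (elemTensorL k m) (hC f).1 hGB
      (hexp hB (fun i x => by rw [hG, hek]) hGB f) (hC' g).1 hKD
      (hexp hD (fun i x => by rw [hK, hem]) hKD g)
    rw [← (splitIndex k m).hasSum_iff] at h3
    rw [hΦ]
    refine (hΨ _).unique ?_
    simp only [S0.coeff_eq_mul hN (hT f g)]
    exact h3
  refine ⟨ContinuousLinearEquiv.equivOfInverse Φ Ψ (fun z => DFunLike.congr_fun h2 z) h1,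
    fun f g x => ?_⟩
  exact (DFunLike.congr_fun (hΦ f g) x).trans (hT f g x)

end
end

/-! ### Assembly of the results on restriction, extension, tensor products and sampling -/

theorem theorem5p1 (d : ℕ) :
    -- restriction to a closed subgroup is a bounded map onto
    (∀ (H : AddSubgroup (Euc d)) [IsClosed (H : Set (Euc d))],
      ∃ R : S0 (Euc d) →L[ℂ] S0 H,
        (∀ (f : S0 (Euc d)) (h : H), R f h = f (h : Euc d)) ∧ Function.Surjective R) ∧
    -- extension from `ℝ^k × {0}` by `f ↦ f ⊗ g`
    (∀ (k m : ℕ) (hd : k + m = d), k < d → ∀ g : S0 (Euc m), g 0 = 1 →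
      ∃ E : S0 (Euc k) →L[ℂ] S0 (Euc d),
        (∀ (f : S0 (Euc k)) (x : Euc d), E f x = f (headCoords hd x) * g (tailCoords hd x)) ∧
        (∀ (f : S0 (Euc k)) (x : Euc d), tailCoords hd x = 0 → E f x = f (headCoords hd x))) ∧
    -- the projective tensor product
    (∀ (k m : ℕ) (hd : k + m = d), k < d →
      ∃ Φ : ProjTensorS0 k m ≃L[ℂ] S0 (Euc d),
        ∀ (f : S0 (Euc k)) (g : S0 (Euc m)) (x : Euc d),
          Φ (elemTensor f g) x = f (headCoords hd x) * g (tailCoords hd x)) ∧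
    -- samples over `ℤ^d`, and over any lattice
    (∃ C : ℝ, 0 < C ∧ ∀ f : S0 (Euc d),
      Summable (fun n : Fin d → ℤ => ‖f (intPoint n)‖) ∧
        ∑' n : Fin d → ℤ, ‖f (intPoint n)‖ ≤ C * ‖f‖) ∧
    (∀ (L : Submodule ℤ (Euc d)) [DiscreteTopology L] [IsZLattice ℝ L],
      ∃ C : ℝ, 0 < C ∧ ∀ f : S0 (Euc d),
        Summable (fun l : L => ‖f (l : Euc d)‖) ∧ ∑' l : L, ‖f (l : Euc d)‖ ≤ C * ‖f‖) ∧
    -- bump functions with small support, and extension from a lattice by semidiscrete convolution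
    (∀ ε : ℝ, 0 < ε →
      ∃ φ : S0 (Euc d), φ 0 = 1 ∧ tsupport (φ : Euc d → ℂ) ⊆ Metric.ball 0 ε) ∧
    (∀ (L : Submodule ℤ (Euc d)) [DiscreteTopology L] [IsZLattice ℝ L] (φ : S0 (Euc d)),
      φ 0 = 1 → tsupport (φ : Euc d → ℂ) ∩ (L : Set (Euc d)) ⊆ {0} →
      ∃ E : lp (fun _ : L => ℂ) 1 →L[ℂ] S0 (Euc d), ∀ c : lp (fun _ : L => ℂ) 1,
        HasSum (fun l : L => c l • S0.translate (l : Euc d) φ) (E c) ∧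
        (∃ σ : StrongDual ℂ (S0 (Euc d)),
          HasSum (fun l : L => c l • S0.dirac (l : Euc d)) σ ∧
          ∀ x : Euc d, E c x = S0.conv σ φ x) ∧
        ∀ l : L, E c (l : Euc d) = c l) := by
  refine ⟨fun H hH => ?_, ?_, ?_, S0.exists_int_sample_bound d,
    fun L _ _ => S0.exists_lattice_sample_bound L, fun ε hε => exists_S0_bump d hε,
    fun L _ _ φ h0 hφ => S0.exists_semidiscrete_convolution L φ h0 hφ⟩
  · obtain ⟨e, he⟩ := exists_freqEmbedding_closed H hH
    obtain ⟨R, hR, hsurj⟩ := e.exists_restriction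
    exact ⟨R, fun f h => by rw [hR, he], hsurj⟩
  · rintro k m rfl - g hg
    obtain ⟨T, hT⟩ := S0.exists_tensor k m
    refine ⟨T.flip g, fun f x => hT f g x, fun f x hx => ?_⟩
    rw [ContinuousLinearMap.flip_apply, hT, hx, hg, mul_one]
  · rintro k m rfl -
    exact S0.exists_projTensor_equiv k m
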